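/- Let $G$ be a connected complex Banach--Lie group with Lie algebra $\mathfrak g$ and exponential map $\exp$, let $P\subseteq G$ be a connected complex Lie subgroup with Lie algebra $\mathfrak p\subseteq\mathfrak g$, let $E$ be a complex Hausdorff locally convex space, and let $\rho\colon P\to \mathrm{GL}(E)$ be a representation of $P$ by continuous linear operators such that all orbit maps $p\mapsto\rho(p)e$, $e\in E$, are holomorphic, with derived representation $d\rho(x)e=\frac{d}{dt}\big|_{t=0}\rho(\exp tx)e$ of $\mathfrak p$ on $E$. Here a map with values in a locally convex space is called holomorphic if it is continuous and, in charts, is locally around each point the sum of a series of continuous homogeneous polynomials. Put $$\mathcal O_\rho(G,E)=\{f\colon G\to E \text{ holomorphic} : f(gp)=\rho(p)^{-1}f(g)\ \text{ for all } g\in G,\ p\in P\}$$ and $$\mathrm{Hom}_{\mathfrak p}(U(\mathfrak g),E)=\{\beta\colon U(\mathfrak g)\to E\ \text{ linear} : \beta(Dx)=-d\rho(x)\beta(D)\ \text{ for all } D\in U(\mathfrak g),\ x\in\mathfrak p\},$$ where $U(\mathfrak g)$ is the enveloping algebra. The latter is a $\mathfrak g$-module by $(x.\beta)(D)=-\beta(xD)$.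 For $x\in\mathfrak g$ let $(X_rf)(g)=\frac{d}{dt}\big|_{t=0}f(\exp(tx)g)$ be the derivative along the right invariant vector field with value $x$ at $\mathbf 1$, and let $D\mapsto D_r$ be the anti-homomorphism from $U(\mathfrak g)$ to right invariant differential operators with $x\mapsto X_r$, so that $(x_1\cdots x_n)_r=(X_n)_r\cdots(X_1)_r$. Then $\Phi(f)(D):=(D_rf)(\mathbf 1)$ defines a linear map (the Taylor map) $$\Phi\colon\mathcal O_\rho(G,E)\to\mathrm{Hom}_{\mathfrak p}(U(\mathfrak g),E),$$ and the image of $\Phi$ is the largest $\mathfrak g$-submodule $V$ of $\mathrm{Hom}_{\mathfrak p}(U(\mathfrak g),E)$ with the following property: the $\mathfrak g$-module structure of $V$ integrates to a $G$-representation, i.e. there is a homomorphism $\pi\colon G\to\mathrm{GL}(V)$ with $$\frac{d}{dt}\Big|_{t=0}(\pi(\exp tx)v)(D)=(x.v)(D)\qquad (x\in\mathfrak g,\ v\in V,\ D\in U(\mathfrak g)),$$ such that, for each $v\in V$, the map $G\to E$, $g\mapsto(\pi(g)v)(\mathbf 1)$ is holomorphic. (That is, the image has this property, and every $\mathfrak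 g$-submodule with this property is contained in the image.) -/

import Mathlib

open scoped Manifold ContDiff Topology
open Filter

noncomputable section

namespace HolInd

section Holomorphic

variable {V : Type*} [NormedAddCommGroup V] [NormedSpace ℂ V]
  {M : Type*} [TopologicalSpace M] [ChartedSpace V M]
  {E : Type*} [AddCommGroup E] [Module ℂ E] [TopologicalSpace E]
  [IsTopologicalAddGroup E] [ContinuousSMul ℂ E]

/-- The inverse of the preferred chart at `x`, translated so that `0` is sent to `x`. -/
def localParam (x : M) (h : V) : M :=
  (extChartAt 𝓘(ℂ, V) x).symm (extChartAt 𝓘(ℂ, V) x x + h)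

/-- Holomorphic (that is, complex analytic) maps from a complex Banach manifold to a complex
topological vector space: `f` is continuous and, in a chart around each point `x`, it is near `x`
the sum `f (x + h) = ∑ₙ βₙ(h)` of continuous homogeneous polynomials `βₙ` of degree `n`. -/
def IsHolomorphic (V : Type*) [NormedAddCommGroup V] [NormedSpace ℂ V] {M : Type*}
    [TopologicalSpace M] [ChartedSpace V M] {E : Type*} [AddCommGroup E] [Module ℂ E]
    [TopologicalSpace E] [IsTopologicalAddGroup E] [ContinuousSMul ℂ E] (f : M → E) : Prop :=
  Continuous f ∧ ∀ x : M, ∃ β : FormalMultilinearSeries ℂ V E,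
    ∀ᶠ h in 𝓝 (0 : V), HasSum (fun n => β n (fun _ => h)) (f (localParam x h))

/-- `e` is the derivative at `t = 0` of the curve `c` in `E`. -/
def HasVelocity (c : ℝ → E) (e : E) : Prop :=
  Tendsto (fun t : ℝ => (t : ℂ)⁻¹ • (c t - c 0)) (𝓝[≠] 0) (𝓝 e)

/-- The derivative at `t = 0` of the curve `c` in `E` (meaningful if it exists). -/
def velocity (c : ℝ → E) : E :=
  limUnder (𝓝[≠] 0) (fun t : ℝ => (t : ℂ)⁻¹ • (c t - c 0))

/-- The tangent map `T_x f : T_x M → E` of a vector valued function. The tangent space `T_x M` is,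
as everywhere in Mathlib, the model space, identified through the preferred chart at `x`; so
`t ↦ localParam x (t v)` is a curve through `x` with velocity `v`. -/
def tangent (V : Type*) [NormedAddCommGroup V] [NormedSpace ℂ V] {M : Type*}
    [TopologicalSpace M] [ChartedSpace V M] {E : Type*} [AddCommGroup E] [Module ℂ E]
    [TopologicalSpace E] (f : M → E) (x : M) (v : TangentSpace 𝓘(ℂ, V) x) : E :=
  velocity (fun t : ℝ => f (localParam x ((t : ℂ) • (show V from v))))

theorem localParam_zero (x : M) : localParam x (0 : V) = x := by
  simp [localParam]

theorem IsHolomorphic.zero : IsHolomorphic V (fun _ : M => (0 : E)) :=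
  ⟨continuous_const, fun _ => ⟨0, Eventually.of_forall fun h => by simp⟩⟩

theorem IsHolomorphic.add {f g : M → E} (hf : IsHolomorphic V f) (hg : IsHolomorphic V g) :
    IsHolomorphic V (fun x => f x + g x) := by
  refine ⟨hf.1.add hg.1, fun x => ?_⟩
  obtain ⟨β, hβ⟩ := hf.2 x
  obtain ⟨γ, hγ⟩ := hg.2 x
  refine ⟨β + γ, ?_⟩
  filter_upwards [hβ, hγ] with h h1 h2
  simpa using h1.add h2

theorem IsHolomorphic.const_smul {f : M → E} (c : ℂ) (hf : IsHolomorphic V f) :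
    IsHolomorphic V (fun x => c • f x) := by
  refine ⟨hf.1.const_smul c, fun x => ?_⟩
  obtain ⟨β, hβ⟩ := hf.2 x
  refine ⟨c • β, ?_⟩
  filter_upwards [hβ] with h h1
  simpa using h1.const_smul c

/-- A holomorphic function has directional derivatives, given by the linear terms of its
expansions. -/
theorem IsHolomorphic.exists_hasVelocity [LocallyConvexSpace ℝ E] [T2Space E] {f : M → E}
    (hf : IsHolomorphic V f) (x : M) (v : V) :
    ∃ e, HasVelocity (fun t : ℝ => f (localParam x ((t : ℂ) • v))) e := by
  obtain ⟨β, hβ⟩ := hf.2 x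
  set a : ℕ → E := fun n => β n (fun _ => v) with ha
  have hsm : ∀ (n : ℕ) (t : ℝ), β n (fun _ => (t : ℂ) • v) = (t : ℂ) ^ n • a n := by
    intro n t
    have := (β n).map_smul_univ (fun _ => (t : ℂ)) (fun _ => v)
    simpa [ha] using this
  have hlim : Tendsto (fun t : ℝ => (t : ℂ) • v) (𝓝 0) (𝓝 (0 : V)) := by
    have : Continuous (fun t : ℝ => (t : ℂ) • v) := by fun_prop
    simpa using this.tendsto 0
  have hev : ∀ᶠ t : ℝ in 𝓝 0,
      HasSum (fun n => (t : ℂ) ^ n • a n) (f (localParam x ((t : ℂ) • v))) := by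
    filter_upwards [hlim.eventually hβ] with t ht
    simpa only [hsm] using ht
  refine ⟨a 1, ?_⟩
  have : ContinuousSMul ℝ E := IsScalarTower.continuousSMul ℂ
  have hws := with_gaugeSeminormFamily (𝕜 := ℝ) (E := E)
  refine (hws.tendsto_nhds _ _).2 fun i ε hε => ?_
  set q : Seminorm ℝ E := gaugeSeminormFamily ℝ E i
  have hqc : Continuous q := hws.continuous_seminorm i
  obtain ⟨r, hr, hball⟩ := Metric.eventually_nhds_iff.1 hev
  set s : ℝ := r / 2 with hs
  have hs0 : 0 < s := by positivity
  have hsum := hball (y := s) (by simp [abs_of_pos hs0]; linarith)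
  obtain ⟨C, hC⟩ : ∃ C, ∀ n, q ((s : ℂ) ^ n • a n) ≤ C := by
    have h1 := (hqc.tendsto 0).comp hsum.summable.tendsto_atTop_zero
    obtain ⟨C, hC⟩ := h1.bddAbove_range
    exact ⟨C, fun n => hC ⟨n, rfl⟩⟩
  have hC0 : 0 ≤ C := (apply_nonneg q _).trans (hC 0)
  have hqs : ∀ (t : ℝ) (n : ℕ) (y : E), q ((t : ℂ) ^ n • y) = |t| ^ n * q y := by
    intro t n y
    rw [← Complex.ofReal_pow, Complex.coe_smul, map_smul_eq_mul, norm_pow, Real.norm_eq_abs]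
  have hqa : ∀ n, q (a n) ≤ C / s ^ n := by
    intro n
    have := hC n
    rw [hqs, abs_of_pos hs0] at this
    rw [le_div_iff₀ (by positivity)]
    linarith
  have hmain : ∀ t : ℝ, t ≠ 0 → |t| ≤ s / 2 →
      q ((t : ℂ)⁻¹ • (f (localParam x ((t : ℂ) • v)) - f (localParam x (((0 : ℝ) : ℂ) • v))) - a 1)
        ≤ |t| * (2 * C / s ^ 2) := by
    intro t ht0 ht
    have hT := hball (y := t) (by simp; linarith)
    have h0 := hball (y := 0) (by simpa using hr)
    have h0' : f (localParam x (((0 : ℝ) : ℂ) • v)) = a 0 := by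
      refine h0.unique ?_
      have := hasSum_single (f := fun n => ((0 : ℝ) : ℂ) ^ n • a n) 0 (fun n hn => by simp [hn])
      simpa using this
    have htc : (t : ℂ) ≠ 0 := by exact_mod_cast ht0
    have h2 : HasSum (fun n => (t : ℂ) ^ (n + 1) • a (n + 2))
        ((t : ℂ)⁻¹ • (f (localParam x ((t : ℂ) • v)) - f (localParam x (((0 : ℝ) : ℂ) • v)))
          - a 1) := by
      have h3 := ((hasSum_nat_add_iff' 2).2 hT).const_smul ((t : ℂ)⁻¹)
      rw [h0']
      convert h3 using 1
      · ext n
        rw [smul_smul]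
        congr 1
        rw [pow_succ, pow_succ, pow_succ]
        field_simp
      · simp only [Finset.sum_range_succ, Finset.sum_range_zero, zero_add, pow_zero, one_smul,
          pow_one, ← sub_sub, smul_sub, smul_smul, inv_mul_cancel₀ htc]
    refine le_of_tendsto ((hqc.tendsto _).comp h2.tendsto_sum_nat) (Eventually.of_forall ?_)
    intro N
    have hterm : ∀ n, q ((t : ℂ) ^ (n + 1) • a (n + 2)) ≤ |t| * (C / s ^ 2) * (1 / 2) ^ n := by
      intro n
      rw [hqs]
      calc |t| ^ (n + 1) * q (a (n + 2)) ≤ |t| ^ (n + 1) * (C / s ^ (n + 2)) := by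
            gcongr
            exact hqa _
        _ = |t| * (C / s ^ 2) * (|t| / s) ^ n := by
            have hs' : s ≠ 0 := hs0.ne'
            clear_value s
            rw [div_pow, pow_succ, pow_add]
            field_simp
        _ ≤ |t| * (C / s ^ 2) * (1 / 2) ^ n := by
            have : |t| / s ≤ 1 / 2 := by
              rw [div_le_iff₀ hs0]
              linarith
            gcongr
    calc q (∑ n ∈ Finset.range N, (t : ℂ) ^ (n + 1) • a (n + 2))
        ≤ ∑ n ∈ Finset.range N, q ((t : ℂ) ^ (n + 1) • a (n + 2)) := by
          induction N with
          | zero => simp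
          | succ N ih =>
            rw [Finset.sum_range_succ, Finset.sum_range_succ]
            exact (map_add_le_add q _ _).trans (by gcongr)
      _ ≤ ∑ n ∈ Finset.range N, |t| * (C / s ^ 2) * (1 / 2) ^ n :=
          Finset.sum_le_sum fun n _ => hterm n
      _ = |t| * (C / s ^ 2) * ∑ n ∈ Finset.range N, (1 / 2 : ℝ) ^ n := by rw [Finset.mul_sum]
      _ ≤ |t| * (C / s ^ 2) * 2 := by
          gcongr
          exact sum_geometric_two_le N
      _ = |t| * (2 * C / s ^ 2) := by ring
  have hsmall : Tendsto (fun t : ℝ => |t| * (2 * C / s ^ 2)) (𝓝[≠] 0) (𝓝 0) := by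
    have : Continuous (fun t : ℝ => |t| * (2 * C / s ^ 2)) := by fun_prop
    have h := this.tendsto 0
    simp only [abs_zero, zero_mul] at h
    exact h.mono_left nhdsWithin_le_nhds
  have hnear : ∀ᶠ t : ℝ in 𝓝[≠] 0, |t| ≤ s / 2 := by
    refine nhdsWithin_le_nhds ?_
    filter_upwards [Metric.ball_mem_nhds (0 : ℝ) (half_pos hs0)] with t ht
    simpa using (Metric.mem_ball.1 ht).le
  filter_upwards [hsmall.eventually (gt_mem_nhds hε), hnear, self_mem_nhdsWithin]
    with t h1 h2 h3
  exact (hmain t h3 h2).trans_lt h1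

theorem HasVelocity.velocity_eq [T2Space E] {c : ℝ → E} {e : E} (h : HasVelocity c e) :
    velocity c = e :=
  h.limUnder_eq

theorem IsHolomorphic.hasVelocity_tangent [LocallyConvexSpace ℝ E] [T2Space E] {f : M → E}
    (hf : IsHolomorphic V f) (x : M) (v : V) :
    HasVelocity (fun t : ℝ => f (localParam x ((t : ℂ) • v))) (tangent V f x v) := by
  obtain ⟨e, he⟩ := hf.exists_hasVelocity x v
  have : tangent V f x v = e := he.velocity_eq
  rwa [this]

theorem tangent_add [LocallyConvexSpace ℝ E] [T2Space E] {f g : M → E}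
    (hf : IsHolomorphic V f) (hg : IsHolomorphic V g) (x : M) (v : V) :
    tangent V (fun y => f y + g y) x v = tangent V f x v + tangent V g x v := by
  refine HasVelocity.velocity_eq ?_
  refine ((hf.hasVelocity_tangent x v).add (hg.hasVelocity_tangent x v)).congr fun t => ?_
  rw [← smul_add, add_sub_add_comm]

theorem tangent_const_smul [LocallyConvexSpace ℝ E] [T2Space E] {f : M → E}
    (hf : IsHolomorphic V f) (c : ℂ) (x : M) (v : V) :
    tangent V (fun y => c • f y) x v = c • tangent V f x v := by
  refine HasVelocity.velocity_eq ?_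
  refine ((hf.hasVelocity_tangent x v).const_smul c).congr fun t => ?_
  rw [smul_comm, smul_sub c]

end Holomorphic

section Group

/-! Throughout, a complex Banach-Lie group is a group `G` with a complex manifold structure,
modelled on a complex Banach space `V`, for which the group operations are holomorphic. -/

variable (V : Type*) [NormedAddCommGroup V] [NormedSpace ℂ V]
  {G : Type*} [TopologicalSpace G] [ChartedSpace V G] [Group G]
  (E : Type*) [AddCommGroup E] [Module ℂ E] [TopologicalSpace E]
  [IsTopologicalAddGroup E] [ContinuousSMul ℂ E]

/-- `γ` is the one-parameter group `t ↦ exp_G (t x)`: the (unique) continuous homomorphism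
`γ : ℝ → G` with `γ' 0 = x`. -/
structure IsOneParameterGroup (x : GroupLieAlgebra 𝓘(ℂ, V) G) (γ : ℝ → G) : Prop where
  continuous : Continuous γ
  map_zero : γ 0 = 1
  map_add : ∀ s t, γ (s + t) = γ s * γ t
  hasDerivAt : HasDerivAt (fun t => extChartAt 𝓘(ℂ, V) (1 : G) (γ t)) (show V from x) 0

variable {E}

/-- The action of the right invariant vector field `X_r` with `X_r 1 = x` on functions:
`(X_r f) g` is the derivative in `1`, in the direction `x`, of `h ↦ f (h g)`. -/
def rightInvDeriv (x : GroupLieAlgebra 𝓘(ℂ, V) G) (f : G → E) (g : G) : E :=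
  tangent V (fun h => f (h * g)) 1 x

/-- `D_r f` for the monomial `D = x₁ ⋯ xₙ`. As `D ↦ D_r` is an anti-homomorphism with
`x ↦ X_r`, this is `(Xₙ)_r (⋯ (X₁)_r f)`. -/
def rightInvDiffOp (D : List (GroupLieAlgebra 𝓘(ℂ, V) G)) (f : G → E) : G → E :=
  D.foldl (fun F x => rightInvDeriv V x F) f

variable (E)

/-- A representation of the complex Banach-Lie group `G`, modelled on `V`, by continuous linear
operators on `E`, with holomorphic orbit maps. -/
structure HolRep (G : Type*) [TopologicalSpace G] [ChartedSpace V G] [Group G] where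
  toHom : G →* (E →L[ℂ] E)
  holomorphic : ∀ e : E, IsHolomorphic V (fun g => toHom g e)

variable {V E}

/-- The derived representation: `x` acts by `e ↦ d/dt|₀ ρ (exp (t x)) e`, the derivative in `1`
and in the direction `x` of the orbit map of `e`. -/
def HolRep.derived [LocallyConvexSpace ℝ E] [T2Space E] (ρ : HolRep V E G)
    (x : GroupLieAlgebra 𝓘(ℂ, V) G) : E →ₗ[ℂ] E where
  toFun e := tangent V (fun g => ρ.toHom g e) 1 x
  map_add' e e' := by
    simpa using tangent_add (ρ.holomorphic e) (ρ.holomorphic e') 1 x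
  map_smul' c e := by
    simpa using tangent_const_smul (ρ.holomorphic e) c 1 x

end Group

section Induction

attribute [local instance 100] LieRing.ofAssociativeRing

variable {V : Type*} [NormedAddCommGroup V] [NormedSpace ℂ V] [CompleteSpace V]
  {G : Type*} [TopologicalSpace G] [ChartedSpace V G] [Group G] [LieGroup 𝓘(ℂ, V) ω G]
  {W : Type*} [NormedAddCommGroup W] [NormedSpace ℂ W]
  {P : Subgroup G} [ChartedSpace W P]
  {E : Type*} [AddCommGroup E] [Module ℂ E] [TopologicalSpace E]
  [IsTopologicalAddGroup E] [ContinuousSMul ℂ E] [LocallyConvexSpace ℝ E] [T2Space E]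

variable (V G) in
/-- The enveloping algebra `U(𝔤)` of the Lie algebra of `G`. -/
abbrev Env : Type _ := UniversalEnvelopingAlgebra ℂ (GroupLieAlgebra 𝓘(ℂ, V) G)

variable (V G) in
/-- The canonical map `𝔤 → U(𝔤)`. -/
abbrev env : GroupLieAlgebra 𝓘(ℂ, V) G →ₗ[ℂ] Env V G :=
  (UniversalEnvelopingAlgebra.ι ℂ).toLinearMap

variable (V W P) in
/-- The differential in `1` of the inclusion `P → G`, i.e. the inclusion `𝔭 → 𝔤` of the Lie
algebra of a Lie subgroup. -/
def lieIncl : GroupLieAlgebra 𝓘(ℂ, W) P → GroupLieAlgebra 𝓘(ℂ, V) G :=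
  fun x => mfderiv 𝓘(ℂ, W) 𝓘(ℂ, V) (Subtype.val : P → G) 1 x

variable (V) in
/-- The space `𝒪_ρ(G, E)` of the holomorphic maps `f : G → E` with `f (g p) = ρ(p)⁻¹ f(g)`. -/
def HolSections (ρ : HolRep W E P) : Submodule ℂ (G → E) where
  carrier := {f | IsHolomorphic V f ∧ ∀ (g : G) (p : P), f (g * p) = ρ.toHom p⁻¹ (f g)}
  add_mem' hf hg := ⟨hf.1.add hg.1, fun g p => by simp [hf.2 g p, hg.2 g p]⟩
  zero_mem' := ⟨IsHolomorphic.zero, fun g p => by simp⟩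
  smul_mem' c f hf := ⟨hf.1.const_smul c, fun g p => by simp [hf.2 g p]⟩

variable (V) in
/-- The coinduced module `Hom_𝔭(U(𝔤), E)`: all linear maps `β : U(𝔤) → E` satisfying
`β(D x) = -dρ(x) β(D)` for `x ∈ 𝔭`. -/
def Coind (ρ : HolRep W E P) : Submodule ℂ (Env V G →ₗ[ℂ] E) where
  carrier := {β | ∀ (x : GroupLieAlgebra 𝓘(ℂ, W) P) (D : Env V G),
    β (D * env V G (lieIncl V W P x)) = -ρ.derived x (β D)}
  add_mem' hβ hγ x D := by
    simp only [LinearMap.add_apply, hβ x D, hγ x D, map_add, neg_add]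
  zero_mem' x D := by simp
  smul_mem' c β hβ x D := by
    simp only [LinearMap.smul_apply, hβ x D, map_smul, smul_neg]

/-- The action of `𝔤` on `Hom_𝔭(U(𝔤), E)`: `(x.β)(D) = -β(x D)`. -/
instance (ρ : HolRep W E P) : LieRingModule (GroupLieAlgebra 𝓘(ℂ, V) G) (Coind V ρ) where
  bracket x β := ⟨-(β.1 ∘ₗ LinearMap.mulLeft ℂ (env V G x)), fun y D => by
    have h := β.2 y (env V G x * D)
    simp only [LinearMap.neg_apply, LinearMap.comp_apply, LinearMap.mulLeft_apply, map_neg]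
    rw [← h, mul_assoc]⟩
  add_lie x y β := by
    apply Subtype.ext
    ext D
    simp [add_mul]
    abel
  lie_add x β γ := by
    apply Subtype.ext
    ext D
    simp
    abel
  leibniz_lie x y β := by
    apply Subtype.ext
    ext D
    have h : env V G ⁅x, y⁆ = env V G x * env V G y - env V G y * env V G x := by
      rw [← LieRing.of_associative_ring_bracket]
      exact LieHom.map_lie (UniversalEnvelopingAlgebra.ι ℂ) x y
    simp [h, sub_mul, mul_assoc]

theorem coind_lie_apply (ρ : HolRep W E P) (x : GroupLieAlgebra 𝓘(ℂ, V) G) (β : Coind V ρ)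
    (D : Env V G) : (⁅x, β⁆ : Coind V ρ).1 D = -β.1 (env V G x * D) :=
  rfl

instance (ρ : HolRep W E P) : LieModule ℂ (GroupLieAlgebra 𝓘(ℂ, V) G) (Coind V ρ) where
  smul_lie c x β := by
    apply Subtype.ext
    ext D
    simp [coind_lie_apply]
  lie_smul c x β := by
    apply Subtype.ext
    ext D
    simp [coind_lie_apply]

/-- `Φ : 𝒪_ρ(G, E) → Hom_𝔭(U(𝔤), E)` is the Taylor map: `Φ(f)(D) = (D_r f)(1)`, for all
monomials `D = x₁ ⋯ xₙ`; as these span `U(𝔤)`, this determines `Φ`. -/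
def IsTaylorMap (ρ : HolRep W E P) (Φ : HolSections V ρ →ₗ[ℂ] Coind V ρ) : Prop :=
  ∀ (f : HolSections V ρ) (D : List (GroupLieAlgebra 𝓘(ℂ, V) G)),
    (Φ f).1 (D.map (env V G)).prod = rightInvDiffOp V D f.1 1

/-- The `𝔤`-module structure of the submodule `N` of `Hom_𝔭(U(𝔤), E)` integrates to a
representation `π` of `G`: there is a homomorphism `π : G → GL(N)` with
`d/dt|₀ π(exp (t x)) v = x.v` for `v ∈ N` and `x ∈ 𝔤`, pointwise on `U(𝔤)`. Moreover,
`g ↦ (π(g) v)(1)` is holomorphic for all `v ∈ N`. -/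
def IntegratesHolomorphically (ρ : HolRep W E P)
    (N : LieSubmodule ℂ (GroupLieAlgebra 𝓘(ℂ, V) G) (Coind V ρ)) : Prop :=
  ∃ π : Representation ℂ G N,
    (∀ (x : GroupLieAlgebra 𝓘(ℂ, V) G) (γ : ℝ → G), IsOneParameterGroup V x γ →
      ∀ (v : N) (D : Env V G), HasVelocity (fun t => (π (γ t) v).1.1 D) ((⁅x, v⁆ : N).1.1 D)) ∧
    ∀ v : N, IsHolomorphic V (fun g => (π g v).1.1 1)

end Induction

end HolInd

end

/-! For a section `f` let `D_l f` denote the left invariant derivative. Left and right invariant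
vector fields commute and agree at 1, so `(D_r f)(1) = (D_l f)(1)` for every monomial
(`rightInvDiffOp_one`). The left operators form an action of `U(𝔤)`, because the bracket of `𝔤` is
that of left invariant fields (`leftInvDeriv_lie`); hence `Φ(f)(D) = (D_l f)(1)` is well defined and
linear in `D`. The right operators preserve `𝒪_ρ(G, E)`; this gives the `𝔭`-condition on `Φ(f)` and
`x.Φ(f) = Φ(-X_r f)`, so the image is a `𝔤`-submodule.

The image integrates. By the identity theorem on the connected group `G`, `Φ` is injective, so left
translation of sections is transported to the image, where `(π(g)Φ(f))(D) = (D_l f)(g⁻¹)`. This is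
holomorphic in `g` and has the required derivative.

The image is maximal. Given `v` in an integrable submodule, put `f(g) = (π(g⁻¹)v)(1)`.
Differentiating gives `(D_l f)(g) = (π(g⁻¹)v)(D)` (`leftInvDiffOp_of_integrates`), so `f` has Taylor
form `v` at 1. For fixed `g`, the maps `p ↦ f(gp)` and `p ↦ ρ(p)⁻¹ f(g)` have the same Taylor
coefficients at 1, since `π(g⁻¹)v` satisfies the `𝔭`-condition; by the identity theorem on the
connected group `P` they coincide.

The analysis in `E` is reduced to Banach spaces by composing with continuous linear maps `T : E →
B`, which detect limits and equality. What cannot be tested this way is that derivatives exist in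
`E` itself, so `TaylorAt` records this as a second condition. It survives composition and
directional differentiation, and a map satisfying it at every point is holomorphic. -/

noncomputable section

namespace HolInd

universe u

/-! ### Testing limits in a locally convex space by maps to Banach spaces -/

section TestMaps

variable {E : Type u} [AddCommGroup E] [Module ℂ E] [TopologicalSpace E]
  [IsTopologicalAddGroup E] [ContinuousSMul ℂ E] [LocallyConvexSpace ℝ E]

omit [ContinuousSMul ℂ E] [LocallyConvexSpace ℝ E] in
/-- Every continuous seminorm is the pullback of the norm of a Banach space. -/
theorem exists_banach_of_seminorm (p : Seminorm ℂ E) (hp : Continuous p) :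
    ∃ (B : Type u) (_ : NormedAddCommGroup B) (_ : NormedSpace ℂ B) (_ : CompleteSpace B)
      (T : E →L[ℂ] B), ∀ e, ‖T e‖ = p e := by
  -- The copy `F` carries the seminorm, so that its topology does not compete with the given
  -- topology of `E`.
  let F := E
  let : SeminormedAddCommGroup F := p.toSeminormedAddCommGroup
  let : NormedSpace ℂ F := { norm_smul_le := fun a b => (map_smul_eq_mul p a b).le }
  let T : F →ₗ[ℂ] UniformSpace.Completion F :=
    (UniformSpace.Completion.toComplₗᵢ (𝕜 := ℂ) (E := F)).toLinearMap
  have hT : ∀ e : F, ‖T e‖ = p e := fun e => UniformSpace.Completion.norm_coe (E := F) e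
  refine ⟨UniformSpace.Completion F, inferInstance, inferInstance, inferInstance,
    ⟨(T : E →ₗ[ℂ] UniformSpace.Completion F), ?_⟩, hT⟩
  refine continuous_iff_continuousAt.2 fun x => ?_
  rw [ContinuousAt, tendsto_iff_norm_sub_tendsto_zero]
  have : Tendsto (fun e : E => p (e - x)) (𝓝 x) (𝓝 0) := by
    have h : Continuous fun e : E => p (e - x) := hp.comp (continuous_id.sub continuous_const)
    simpa using h.tendsto x
  refine this.congr fun e => ?_
  rw [← hT]
  exact congrArg norm (map_sub T e x)

-- Nonnegative complex scalars are real, so real and complex convexity agree. This makes complex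
-- gauge seminorms available.
omit [IsTopologicalAddGroup E] [ContinuousSMul ℂ E] in
open ComplexOrder in
theorem locallyConvexSpace_complex : LocallyConvexSpace ℂ E :=
  ⟨fun x => by simpa only [convex_RCLike_iff_convex_real (K := ℂ)] using
    LocallyConvexSpace.convex_basis (𝕜 := ℝ) x⟩

/-- The topology of `E` is defined by complex gauge seminorms, and each of them is the norm of some
`T e` in a Banach space. -/
theorem tendsto_of_forall_clm {α : Type*} {l : Filter α} {f : α → E} {e : E}
    (h : ∀ (B : Type u) [NormedAddCommGroup B] [NormedSpace ℂ B] [CompleteSpace B]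
      (T : E →L[ℂ] B), Tendsto (fun a => T (f a)) l (𝓝 (T e))) : Tendsto f l (𝓝 e) := by
  have : ContinuousSMul ℝ E := IsScalarTower.continuousSMul ℂ
  have := locallyConvexSpace_complex (E := E)
  have hws := with_gaugeSeminormFamily (𝕜 := ℂ) (E := E)
  refine (hws.tendsto_nhds _ _).2 fun i ε hε => ?_
  obtain ⟨B, _, _, _, T, hT⟩ :=
    exists_banach_of_seminorm (gaugeSeminormFamily ℂ E i) (hws.continuous_seminorm i)
  have := (tendsto_iff_norm_sub_tendsto_zero.1 (h B T)).eventually (gt_mem_nhds hε)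
  filter_upwards [this] with a ha
  rwa [← map_sub, hT] at ha

theorem eq_of_forall_clm [T2Space E] {e e' : E}
    (h : ∀ (B : Type u) [NormedAddCommGroup B] [NormedSpace ℂ B] [CompleteSpace B]
      (T : E →L[ℂ] B), T e = T e') : e = e' := by
  have : Tendsto (fun _ : Unit => e) ⊤ (𝓝 e') :=
    tendsto_of_forall_clm fun B _ _ _ T => by rw [h B T]; exact tendsto_const_nhds
  exact tendsto_nhds_unique tendsto_const_nhds this

theorem hasSum_of_forall_clm {ι : Type*} {f : ι → E} {e : E}
    (h : ∀ (B : Type u) [NormedAddCommGroup B] [NormedSpace ℂ B] [CompleteSpace B]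
      (T : E →L[ℂ] B), HasSum (fun a => T (f a)) (T e)) : HasSum f e := by
  refine tendsto_of_forall_clm fun B _ _ _ T => ?_
  simpa [HasSum] using h B T

theorem continuous_of_forall_clm {X : Type*} [TopologicalSpace X] {f : X → E}
    (h : ∀ (B : Type u) [NormedAddCommGroup B] [NormedSpace ℂ B] [CompleteSpace B]
      (T : E →L[ℂ] B), Continuous (fun a => T (f a))) : Continuous f :=
  continuous_iff_continuousAt.2 fun x => tendsto_of_forall_clm fun B _ _ _ T => (h B T).tendsto x

end TestMaps

/-! ### Maps with Taylor coefficients in `E` -/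

section Taylor

variable {V : Type*} [NormedAddCommGroup V] [NormedSpace ℂ V]
  {V' : Type*} [NormedAddCommGroup V'] [NormedSpace ℂ V']
  {E : Type u} [AddCommGroup E] [Module ℂ E] [TopologicalSpace E]

/-- A map `f : V → E` is analytic at `x` when tested against continuous linear maps from `E` to
Banach spaces, and the derivatives of `f` at `x` exist in `E`. -/
def TaylorAt (f : V → E) (x : V) : Prop :=
  (∀ (B : Type u) [NormedAddCommGroup B] [NormedSpace ℂ B] [CompleteSpace B] (T : E →L[ℂ] B),
    AnalyticAt ℂ (fun y => T (f y)) x) ∧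
  ∀ (n : ℕ) (v : Fin n → V), ∃ e : E, ∀ (B : Type u) [NormedAddCommGroup B] [NormedSpace ℂ B]
    [CompleteSpace B] (T : E →L[ℂ] B), iteratedFDeriv ℂ n (fun y => T (f y)) x v = T e

theorem TaylorAt.congr {f g : V → E} {x : V} (hf : TaylorAt f x) (h : f =ᶠ[𝓝 x] g) :
    TaylorAt g x := by
  have h' : ∀ (B : Type u) [NormedAddCommGroup B] [NormedSpace ℂ B] [CompleteSpace B]
      (T : E →L[ℂ] B), (fun y => T (f y)) =ᶠ[𝓝 x] fun y => T (g y) := fun B _ _ _ T => by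
    filter_upwards [h] with y hy
    rw [hy]
  refine ⟨fun B _ _ _ T => (hf.1 B T).congr (h' B T), fun n v => ?_⟩
  obtain ⟨e, he⟩ := hf.2 n v
  exact ⟨e, fun B _ _ _ T => by rw [← he B T, ((h' B T).iteratedFDeriv ℂ n).eq_of_nhds]⟩

/-- By Faà di Bruno's formula a derivative of `T ∘ f ∘ φ` is a finite sum of derivatives of `T ∘ f`
at arguments built from `φ` alone. These arguments do not depend on `T`, so one sum of vectors of
`E` serves every `T`. -/
theorem TaylorAt.comp [CompleteSpace V] {f : V → E} {φ : V' → V} {x : V'} (hf : TaylorAt f (φ x))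
    (hφ : AnalyticAt ℂ φ x) : TaylorAt (fun y => f (φ y)) x := by
  refine ⟨fun B _ _ _ T => (hf.1 B T).comp hφ, fun n v => ?_⟩
  choose e he using hf.2
  refine ⟨∑ c : OrderedFinpartition n, e c.length
    (c.applyOrderedFinpartition (fun m => ftaylorSeries ℂ φ x (c.partSize m)) v),
    fun B _ _ _ T => ?_⟩
  have h := iteratedFDeriv_comp (n := ω) (hf.1 B T).contDiffAt hφ.contDiffAt (i := n) le_top
  have h' : (fun y => T (f (φ y))) = (fun y => T (f y)) ∘ φ := rfl
  rw [h', h]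
  simp only [FormalMultilinearSeries.taylorComp, sum_apply, map_sum,
    FormalMultilinearSeries.compAlongOrderedFinpartition_apply]
  exact Finset.sum_congr rfl fun c _ => he _ _ B T

/-- The `n`-th derivative of `y ↦ Df(y)v` is the `(n+1)`-st derivative of `f` with `v` in the last
slot. -/
theorem TaylorAt.fderiv_apply {f g : V → E} {x : V} (v : V) (hf : TaylorAt f x)
    (hg : ∀ (B : Type u) [NormedAddCommGroup B] [NormedSpace ℂ B] [CompleteSpace B]
      (T : E →L[ℂ] B), (fun y => T (g y)) =ᶠ[𝓝 x] fun y => fderiv ℂ (fun z => T (f z)) y v) :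
    TaylorAt g x := by
  refine ⟨fun B _ _ _ T => ?_, fun n w => ?_⟩
  · have h1 := (hf.1 B T).fderiv
    have h2 : AnalyticAt ℂ (fun y => fderiv ℂ (fun z => T (f z)) y v) x :=
      (ContinuousLinearMap.apply ℂ B v).analyticAt _ |>.comp h1
    exact h2.congr (hg B T).symm
  · obtain ⟨e, he⟩ := hf.2 (n + 1) (Fin.snoc w v)
    refine ⟨e, fun B _ _ _ T => ?_⟩
    rw [((hg B T).iteratedFDeriv ℂ n).eq_of_nhds, ← he B T, iteratedFDeriv_succ_apply_right]
    have h := ((ContinuousLinearMap.apply ℂ B v).iteratedFDeriv_comp_left (n := ω)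
      (hf.1 B T).fderiv.contDiffAt (i := n) le_top)
    have h' : (fun y => fderiv ℂ (fun z => T (f z)) y v) =
      (ContinuousLinearMap.apply ℂ B v) ∘ fun y => fderiv ℂ (fun z => T (f z)) y := rfl
    rw [h', h]
    simp

/-- A map with Taylor series at all points of a ball is on this ball the sum of its Taylor series
at the centre. -/
theorem exists_hasSum_of_taylorAt [IsTopologicalAddGroup E] [ContinuousSMul ℂ E]
    [LocallyConvexSpace ℝ E] [T2Space E] {f : V → E} {r : ℝ} (hr : 0 < r)
    (hf : ∀ y ∈ Metric.ball (0 : V) r, TaylorAt f y) :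
    ∃ β : FormalMultilinearSeries ℂ V E,
      ∀ h ∈ Metric.ball (0 : V) r, HasSum (fun n => β n (fun _ => h)) (f h) := by
  have h0 := hf 0 (by simpa using hr)
  choose e he using h0.2
  -- The Taylor coefficients; multilinearity and continuity hold because they hold after every `T`.
  let β : FormalMultilinearSeries ℂ V E := fun n =>
    { toFun := fun v => ((Nat.factorial n : ℂ)⁻¹) • e n v
      map_update_add' := fun {_} v i x y => eq_of_forall_clm fun B _ _ _ T => by
        rw [map_smul, map_add, map_smul, map_smul, ← he, ← he, ← he, ← smul_add]
        congr 1
        convert (iteratedFDeriv ℂ n (fun y => T (f y)) 0).map_update_add v i x y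
      map_update_smul' := fun {_} v i c x => eq_of_forall_clm fun B _ _ _ T => by
        rw [map_smul, map_smul, map_smul, ← he, ← he, smul_comm]
        congr 1
        convert (iteratedFDeriv ℂ n (fun y => T (f y)) 0).map_update_smul v i c x
      cont := continuous_of_forall_clm fun B _ _ _ T => by
        have : Continuous fun v => ((Nat.factorial n : ℂ)⁻¹) •
            iteratedFDeriv ℂ n (fun y => T (f y)) 0 v :=
          (iteratedFDeriv ℂ n (fun y => T (f y)) 0).cont.const_smul _
        refine this.congr fun v => ?_
        rw [he, ← map_smul] }
  refine ⟨β, fun h hh => hasSum_of_forall_clm fun B _ _ _ T => ?_⟩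
  -- Restrict to the complex line through `h`: the disc where `z • h` stays in the ball has radius
  -- above 1, so the one-variable Taylor expansion may be evaluated at `z = 1`. This gives
  -- convergence on the whole ball, not only near 0.
  obtain ⟨s, hs1, hs⟩ : ∃ s : ℝ, 1 < s ∧ ∀ z ∈ Metric.ball (0 : ℂ) s,
      z • h ∈ Metric.ball (0 : V) r := by
    rcases eq_or_ne h 0 with rfl | hne
    · exact ⟨2, by norm_num, fun z _ => by simpa using hr⟩
    · have hpos : 0 < ‖h‖ := norm_pos_iff.2 hne
      refine ⟨r / ‖h‖, ?_, fun z hz => ?_⟩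
      · rw [lt_div_iff₀ hpos]
        simpa using hh
      · rw [mem_ball_zero_iff] at hz ⊢
        rw [norm_smul]
        exact (lt_div_iff₀ hpos).1 hz
  set L : ℂ →L[ℂ] V := (ContinuousLinearMap.id ℂ ℂ).smulRight h with hL
  have hLz : ∀ z, L z = z • h := fun z => by simp [hL]
  have hd : DifferentiableOn ℂ (fun z => T (f (L z))) (Metric.ball (0 : ℂ) s) := by
    intro z hz
    have h1 : AnalyticAt ℂ (fun y => T (f y)) (L z) := by
      rw [hLz]
      exact (hf _ (hs z hz)).1 B T
    exact (h1.comp (L.analyticAt z)).differentiableAt.differentiableWithinAt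
  have key := Complex.hasSum_taylorSeries_on_ball hd (z := 1) (by simpa using hs1)
  have hL1 : L 1 = h := by simp [hLz]
  rw [hL1] at key
  convert key using 2 with n
  -- It remains to match the coefficients on the line, `iteratedDeriv` at 0, with the diagonal
  -- values of the derivatives of `T ∘ f`.
  obtain ⟨p, R, hp⟩ := h0.1 B T
  have hp' : HasFPowerSeriesAt (fun y => T (f y)) p (L 0) := by
    rw [map_zero]
    exact ⟨R, hp⟩
  obtain ⟨R', hq⟩ := hp'.compContinuousLinearMap (u := L) (x := 0)
  have e1 := hp.factorial_smul h n
  have e2 := hq.factorial_smul 1 n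
  rw [FormalMultilinearSeries.compContinuousLinearMap_apply] at e2
  simp only [Function.comp_def, hL1] at e2
  rw [iteratedDeriv_eq_iteratedFDeriv, ← e2, e1, he]
  simp only [sub_zero, one_pow, one_smul]
  exact map_smul T _ _

end Taylor

/-! ### Polarization -/

section Polarization

/-- The polarization formula for a multilinear map. -/
theorem sum_perm_eq_sum_powerset {R V B : Type*} [CommRing R] [AddCommGroup V] [Module R V]
    [AddCommGroup B] [Module R B] {n : ℕ} (f : MultilinearMap R (fun _ : Fin n => V) B)
    (x : Fin n → V) :
    ∑ σ : Equiv.Perm (Fin n), f (fun i => x (σ i)) =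
      ∑ S ∈ (Finset.univ : Finset (Fin n)).powerset,
        (-1 : ℤ) ^ S.card • f (fun _ => ∑ i ∈ Sᶜ, x i) := by
  classical
  -- Multilinear expansion yields all index maps `g` with values in `Sᶜ`, that is, those with `S`
  -- disjoint from the image of `g`.
  have h1 : ∀ S : Finset (Fin n), f (fun _ => ∑ i ∈ Sᶜ, x i) =
      ∑ g : Fin n → Fin n, if S ⊆ (Finset.univ.image g)ᶜ then f (fun j => x (g j)) else 0 := by
    intro S
    rw [f.map_sum_finset (fun _ i => x i) (fun _ => Sᶜ), ← Finset.sum_filter]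
    refine Finset.sum_congr ?_ fun _ _ => rfl
    ext g
    simp only [Fintype.mem_piFinset, Finset.mem_compl, Finset.mem_filter, Finset.mem_univ,
      true_and, Finset.subset_iff, Finset.mem_image, not_exists]
    exact ⟨fun h i hi j hj => h j (hj ▸ hi), fun h j hj => h hj j rfl⟩
  simp only [h1, Finset.smul_sum]
  rw [Finset.sum_comm]
  -- For fixed `g` the signs are summed over all subsets of the complement of the image. They cancel
  -- unless this complement is empty, i.e. `g` is a permutation.
  have h2 : ∀ g : Fin n → Fin n,
      (∑ S ∈ (Finset.univ : Finset (Fin n)).powerset, (-1 : ℤ) ^ S.card •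
        (if S ⊆ (Finset.univ.image g)ᶜ then f (fun j => x (g j)) else 0)) =
      if Function.Bijective g then f (fun j => x (g j)) else 0 := by
    intro g
    simp only [smul_ite, smul_zero]
    rw [← Finset.sum_filter, ← Finset.sum_smul]
    have h3 : (Finset.univ : Finset (Fin n)).powerset.filter (· ⊆ (Finset.univ.image g)ᶜ) =
        ((Finset.univ.image g)ᶜ).powerset := by
      ext S
      simp
    rw [h3, Finset.sum_powerset_neg_one_pow_card]
    have h4 : (Finset.univ.image g)ᶜ = ∅ ↔ Function.Bijective g := by
      rw [Finset.compl_eq_empty_iff, ← Finite.surjective_iff_bijective, ← Finset.coe_eq_univ,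
        Finset.coe_image, Finset.coe_univ, Set.image_univ, Set.range_eq_univ]
    simp only [h4, ite_smul, one_smul, zero_smul]
  rw [Finset.sum_congr rfl fun g _ => h2 g, ← Finset.sum_filter]
  refine Finset.sum_bij' (fun σ _ => (σ : Fin n → Fin n))
    (fun g hg => Equiv.ofBijective g (Finset.mem_filter.1 hg).2) ?_ ?_ ?_ ?_ ?_
  · intro σ _
    exact Finset.mem_filter.2 ⟨Finset.mem_univ _, σ.bijective⟩
  · simp
  · intro σ _
    ext
    simp
  · intro g _
    ext
    simp
  · simp

end Polarization

/-! ### Series of homogeneous polynomials and Cauchy estimates -/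

section Cauchy

variable {V : Type*} [NormedAddCommGroup V] [NormedSpace ℂ V]
  {B : Type*} [NormedAddCommGroup B] [NormedSpace ℂ B] [CompleteSpace B]

/-- Cauchy estimates for a convergent series of homogeneous polynomials. -/
theorem norm_diag_le_of_hasSum {F : V → B} {β : FormalMultilinearSeries ℂ V B} {r M : ℝ}
    (hs : ∀ h : V, ‖h‖ < r → HasSum (fun n => β n (fun _ => h)) (F h))
    (hM : ∀ h : V, ‖h‖ < r → ‖F h‖ ≤ M) (n : ℕ) {h : V} (hh : ‖h‖ < r) :
    ‖β n (fun _ => h)‖ ≤ M := by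
  obtain ⟨s, hs1, hsr⟩ : ∃ s : ℝ, 1 < s ∧ ∀ z : ℂ, ‖z‖ ≤ s → ‖z • h‖ < r := by
    rcases eq_or_ne h 0 with rfl | hne
    · exact ⟨2, by norm_num, fun z _ => by simpa using hh⟩
    · have hpos : 0 < ‖h‖ := norm_pos_iff.2 hne
      obtain ⟨s, h1, h2⟩ := exists_between ((one_lt_div hpos).2 hh)
      refine ⟨s, h1, fun z hz => ?_⟩
      rw [norm_smul]
      exact (lt_div_iff₀ hpos).1 (hz.trans_lt h2)
  set L : ℂ →L[ℂ] V := (ContinuousLinearMap.id ℂ ℂ).smulRight h with hL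
  have hLz : ∀ z, L z = z • h := fun z => by simp [hL]
  set q : FormalMultilinearSeries ℂ ℂ B := β.compContinuousLinearMap L with hq
  have hqn : ∀ (n : ℕ) (z : ℂ), q n (fun _ => z) = β n (fun _ => z • h) := fun n z => by
    rw [hq, FormalMultilinearSeries.compContinuousLinearMap_apply]
    exact congrArg (β n) (funext fun _ => hLz z)
  have hqs : ∀ z : ℂ, ‖z‖ ≤ s → HasSum (fun n => q n (fun _ => z)) (F (z • h)) := fun z hz => by
    simp only [hqn]
    exact hs _ (hsr z hz)
  lift s to NNReal using by linarith
  -- Convergence at the single point `s > 1` forces the radius to be at least `s`, so the closed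
  -- unit disc lies inside and Cauchy's estimate applies on the unit circle.
  have hrad : (s : ENNReal) ≤ q.radius := by
    refine q.le_radius_of_tendsto (l := 0) ?_
    have h1 := (hqs (s : ℝ) (by simp)).summable.tendsto_atTop_zero.norm
    rw [norm_zero] at h1
    refine h1.congr fun n => ?_
    rw [FormalMultilinearSeries.apply_eq_pow_smul_coeff, norm_smul,
      FormalMultilinearSeries.norm_apply_eq_norm_coef, mul_comm]
    simp
  have hball : HasFPowerSeriesOnBall (fun z : ℂ => F (z • h)) q 0 s := by
    refine ⟨hrad, by exact_mod_cast (zero_lt_one.trans hs1), fun {y} hy => ?_⟩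
    rw [zero_add]
    refine hqs y ?_
    rw [Metric.eball_coe, mem_ball_zero_iff] at hy
    exact hy.le
  have hdiff : DiffContOnCl ℂ (fun z : ℂ => F (z • h)) (Metric.ball 0 1) := by
    refine (hball.differentiableOn.mono ?_).diffContOnCl
    rw [closure_ball _ one_ne_zero, Metric.eball_coe]
    exact Metric.closedBall_subset_ball hs1
  have key := Complex.norm_iteratedDeriv_le_of_forall_mem_sphere_norm_le n one_pos hdiff
    (C := M) fun z hz => hM _ (hsr z (by rw [mem_sphere_zero_iff_norm.1 hz]; exact hs1.le))
  rw [iteratedDeriv_eq_iteratedFDeriv, ← hball.factorial_smul, hqn, one_smul, one_pow, div_one,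
    ← Nat.cast_smul_eq_nsmul ℝ, norm_smul, Real.norm_natCast] at key
  exact le_of_mul_le_mul_left key (by positivity)

/-- Rescale `h` to norm `r / 2`, strictly inside the ball, and use homogeneity; this is the source
of the factor 2. -/
theorem norm_diag_le_pow_of_hasSum {F : V → B} {β : FormalMultilinearSeries ℂ V B} {r M : ℝ}
    (hr : 0 < r) (hs : ∀ h : V, ‖h‖ ≤ r → HasSum (fun n => β n (fun _ => h)) (F h))
    (hM : ∀ h : V, ‖h‖ ≤ r → ‖F h‖ ≤ M) (n : ℕ) (h : V) :
    ‖β n (fun _ => h)‖ ≤ M * (2 * ‖h‖ / r) ^ n := by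
  have hle : ∀ h : V, ‖h‖ < r → ‖β n (fun _ => h)‖ ≤ M := fun h hh =>
    norm_diag_le_of_hasSum (fun h hh => hs h hh.le) (fun h hh => hM h hh.le) n hh
  rcases eq_or_ne h 0 with rfl | hne
  · rcases n with _ | n
    · simpa using hle 0 (by simpa using hr)
    · rw [(β (n + 1)).map_coord_zero 0 rfl]
      simp
  · have hpos : 0 < ‖h‖ := norm_pos_iff.2 hne
    have hc : 0 < r / (2 * ‖h‖) := by positivity
    have h1 := hle (((r / (2 * ‖h‖) : ℝ) : ℂ) • h) (by
      rw [norm_smul, Complex.norm_real, Real.norm_of_nonneg hc.le]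
      field_simp
      linarith)
    have h2 := (β n).map_smul_univ (fun _ => ((r / (2 * ‖h‖) : ℝ) : ℂ)) (fun _ => h)
    rw [h2, Finset.prod_const, Finset.card_univ, Fintype.card_fin, norm_smul, norm_pow,
      Complex.norm_real, Real.norm_of_nonneg hc.le, mul_comm, ← le_div_iff₀ (by positivity)] at h1
    refine h1.trans_eq ?_
    rw [div_eq_mul_inv, ← inv_pow, inv_div]

/-- The symmetrization of a power series. -/
def symmSeries (β : FormalMultilinearSeries ℂ V B) : FormalMultilinearSeries ℂ V B := fun n =>
  ((Nat.factorial n : ℂ)⁻¹) • ∑ σ : Equiv.Perm (Fin n), (β n).domDomCongr σ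

omit [CompleteSpace B] in
theorem symmSeries_apply (β : FormalMultilinearSeries ℂ V B) (n : ℕ) (x : Fin n → V) :
    symmSeries β n x = ((Nat.factorial n : ℂ)⁻¹) • ∑ σ : Equiv.Perm (Fin n),
      β n (fun i => x (σ i)) := by
  simp [symmSeries]

omit [CompleteSpace B] in
theorem symmSeries_diag (β : FormalMultilinearSeries ℂ V B) (n : ℕ) (h : V) :
    symmSeries β n (fun _ => h) = β n (fun _ => h) := by
  rw [symmSeries_apply, Finset.sum_const, Finset.card_univ, Fintype.card_perm, Fintype.card_fin,
    ← Nat.cast_smul_eq_nsmul ℂ, smul_smul, inv_mul_cancel₀ (by exact_mod_cast n.factorial_ne_zero),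
    one_smul]

-- The estimates control `β n` on the diagonal only, which says nothing about its non-symmetric
-- part; hence the passage to `symmSeries`. Polarization writes the symmetrization through `2 ^ n`
-- diagonal values at vectors of norm at most `n`, and `n ^ n / n! ≤ e ^ n` produces the constant `2
-- * C * e`.
omit [CompleteSpace B] in
theorem norm_symmSeries_le {β : FormalMultilinearSeries ℂ V B} {C M : ℝ} (hC : 0 ≤ C)
    (hM : 0 ≤ M) (hβ : ∀ n h, ‖β n (fun _ => h)‖ ≤ M * (C * ‖h‖) ^ n) (n : ℕ) :
    ‖symmSeries β n‖ ≤ M * (2 * C * Real.exp 1) ^ n := by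
  have hunit : ∀ x : Fin n → V, (∀ i, ‖x i‖ ≤ 1) →
      ‖symmSeries β n x‖ ≤ M * (2 * C * Real.exp 1) ^ n := by
    intro x hx
    have h0 : ∑ σ : Equiv.Perm (Fin n), β n (fun i => x (σ i)) = _ :=
      sum_perm_eq_sum_powerset (β n).toMultilinearMap x
    rw [symmSeries_apply, h0, norm_smul]
    have h1 : ‖∑ S ∈ (Finset.univ : Finset (Fin n)).powerset,
        (-1 : ℤ) ^ S.card • (β n).toMultilinearMap (fun _ => ∑ i ∈ Sᶜ, x i)‖ ≤
        ∑ S ∈ (Finset.univ : Finset (Fin n)).powerset, M * (C * n) ^ n := by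
      refine norm_sum_le_of_le _ fun S _ => ?_
      have h2 : ‖(-1 : ℤ) ^ S.card • (β n).toMultilinearMap (fun _ => ∑ i ∈ Sᶜ, x i)‖ =
          ‖β n (fun _ => ∑ i ∈ Sᶜ, x i)‖ := by
        rcases neg_one_pow_eq_or ℤ S.card with h | h <;> simp [h]
      rw [h2]
      refine (hβ n _).trans ?_
      gcongr
      calc ‖∑ i ∈ Sᶜ, x i‖ ≤ ∑ i ∈ Sᶜ, (1 : ℝ) := norm_sum_le_of_le _ fun i _ => hx i
        _ ≤ n := by
          rw [Finset.sum_const, nsmul_eq_mul, mul_one]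
          exact_mod_cast (Finset.card_le_univ _).trans_eq (Fintype.card_fin n)
    rw [Finset.sum_const, Finset.card_powerset, Finset.card_univ, Fintype.card_fin] at h1
    have h3 : ‖((Nat.factorial n : ℂ)⁻¹)‖ = ((Nat.factorial n : ℝ))⁻¹ := by simp
    rw [h3]
    calc ((Nat.factorial n : ℝ))⁻¹ * _ ≤ ((Nat.factorial n : ℝ))⁻¹ *
          ((2 ^ n) • (M * (C * n) ^ n)) := by gcongr
      _ = M * (2 * C) ^ n * ((n : ℝ) ^ n / Nat.factorial n) := by
          rw [nsmul_eq_mul, mul_pow, mul_pow]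
          push_cast
          ring
      _ ≤ M * (2 * C) ^ n * Real.exp n := by
          gcongr
          exact Real.pow_div_factorial_le_exp _ (Nat.cast_nonneg _) _
      _ = M * (2 * C * Real.exp 1) ^ n := by
          rw [mul_pow _ (Real.exp 1), ← Real.exp_nat_mul, mul_one, mul_assoc]
  refine ContinuousMultilinearMap.opNorm_le_bound (by positivity) fun x => ?_
  -- Normalize each entry. A zero entry is harmless, as `0⁻¹ = 0` keeps the normalized vector of
  -- norm at most 1.
  have h1 : x = fun i => ((‖x i‖ : ℝ) : ℂ) • (((‖x i‖ : ℝ) : ℂ)⁻¹ • x i) := by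
    ext i
    rcases eq_or_ne (x i) 0 with h | h
    · simp [h]
    · rw [smul_smul, mul_inv_cancel₀ (by simpa using h), one_smul]
  rw [h1, ContinuousMultilinearMap.map_smul_univ, norm_smul, mul_comm, ← h1]
  have h2 : ‖∏ i, ((‖x i‖ : ℝ) : ℂ)‖ = ∏ i, ‖x i‖ := by simp [norm_prod]
  rw [h2]
  gcongr
  refine hunit _ fun i => ?_
  rw [norm_smul, norm_inv, Complex.norm_real, norm_norm]
  exact inv_mul_le_one

/-- A bounded sum of a series of homogeneous polynomials is analytic. -/
theorem hasFPowerSeriesAt_of_hasSum {F : V → B} {β : FormalMultilinearSeries ℂ V B}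
    (hF : ContinuousAt F 0) (hs : ∀ᶠ h in 𝓝 (0 : V), HasSum (fun n => β n (fun _ => h)) (F h)) :
    HasFPowerSeriesAt F (symmSeries β) 0 := by
  -- Continuity at 0 supplies the uniform bound `‖F 0‖ + 1` that the Cauchy estimates need.
  obtain ⟨r, hr, hball⟩ := Metric.eventually_nhds_iff_ball.1
    (hs.and (hF.norm.eventually (gt_mem_nhds (lt_add_one ‖F 0‖))))
  have hlt : ∀ h : V, ‖h‖ ≤ r / 2 → h ∈ Metric.ball (0 : V) r := fun h hh => by
    rw [mem_ball_zero_iff]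
    linarith
  set M := ‖F 0‖ + 1
  have hdiag := norm_diag_le_pow_of_hasSum (M := M) (half_pos hr)
    (fun h hh => (hball h (hlt h hh)).1) (fun h hh => (hball h (hlt h hh)).2.le)
  have hC : (0 : ℝ) < 2 / (r / 2) := by positivity
  have hbd := norm_symmSeries_le (β := β) (M := M) hC.le (by positivity) (fun n h => by
    rw [div_mul_eq_mul_div]
    exact hdiag n h)
  set K := 2 * (2 / (r / 2)) * Real.exp 1
  have hK : 0 < K := by positivity
  have hrad : ENNReal.ofReal K⁻¹ ≤ (symmSeries β).radius := by
    refine (symmSeries β).le_radius_of_bound M fun n => ?_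
    rw [Real.coe_toNNReal _ (by positivity)]
    calc ‖symmSeries β n‖ * K⁻¹ ^ n ≤ M * K ^ n * K⁻¹ ^ n := by
          gcongr
          exact hbd n
      _ = M := by rw [mul_assoc, ← mul_pow, mul_inv_cancel₀ hK.ne', one_pow, mul_one]
  refine ⟨min (ENNReal.ofReal K⁻¹) (ENNReal.ofReal r), (min_le_left _ _).trans hrad, ?_, ?_⟩
  · simp [hK, hr]
  · intro y hy
    rw [zero_add]
    simp only [symmSeries_diag]
    refine (hball y ?_).1
    have := Metric.eball_subset_eball (min_le_right _ _) hy
    rwa [Metric.eball_ofReal] at this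

end Cauchy

/-- The `n`-th derivative at 0 is the sum of `β n` over all permutations of its arguments. This
vector lies in `E` and is the same for all `T`. -/
theorem taylorAt_of_hasSum {V : Type*} [NormedAddCommGroup V] [NormedSpace ℂ V]
    {E : Type u} [AddCommGroup E] [Module ℂ E] [TopologicalSpace E] [IsTopologicalAddGroup E]
    [ContinuousSMul ℂ E] {F : V → E} {β : FormalMultilinearSeries ℂ V E}
    (hF : ContinuousAt F 0) (hs : ∀ᶠ h in 𝓝 (0 : V), HasSum (fun n => β n (fun _ => h)) (F h)) :
    TaylorAt F 0 := by
  have key : ∀ (B : Type u) [NormedAddCommGroup B] [NormedSpace ℂ B] [CompleteSpace B]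
      (T : E →L[ℂ] B), HasFPowerSeriesAt (fun y => T (F y))
        (symmSeries (fun n => T.compContinuousMultilinearMap (β n))) 0 := fun B _ _ _ T => by
    refine hasFPowerSeriesAt_of_hasSum (T.continuous.continuousAt.comp hF) ?_
    filter_upwards [hs] with h hh
    exact T.hasSum hh
  refine ⟨fun B _ _ _ T => (key B T).analyticAt, fun n v => ?_⟩
  refine ⟨∑ σ : Equiv.Perm (Fin n), β n (fun i => v (σ i)), fun B _ _ _ T => ?_⟩
  obtain ⟨r, hr⟩ := key B T
  rw [hr.iteratedFDeriv_eq_sum_of_completeSpace]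
  have h1 : ∀ σ : Equiv.Perm (Fin n),
      symmSeries (fun n => T.compContinuousMultilinearMap (β n)) n (fun i => v (σ i)) =
        ((Nat.factorial n : ℂ)⁻¹) • T (∑ τ : Equiv.Perm (Fin n), β n (fun i => v (τ i))) := by
    intro σ
    refine (symmSeries_apply _ n _).trans ?_
    rw [map_sum, ← Equiv.sum_comp (Equiv.mulLeft σ)
      (fun τ => T (β n (fun i => v (τ i))))]
    rfl
  rw [Finset.sum_congr rfl fun σ _ => h1 σ, Finset.sum_const, Finset.card_univ,
    Fintype.card_perm, Fintype.card_fin, ← Nat.cast_smul_eq_nsmul ℂ, smul_smul,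
    mul_inv_cancel₀ (by exact_mod_cast n.factorial_ne_zero), one_smul]

/-! ### Holomorphic maps on manifolds in terms of `TaylorAt` -/

section Manifold

variable {V : Type*} [NormedAddCommGroup V] [NormedSpace ℂ V] [CompleteSpace V]
  {M : Type*} [TopologicalSpace M] [ChartedSpace V M]
  {V' : Type*} [NormedAddCommGroup V'] [NormedSpace ℂ V'] [CompleteSpace V']
  {M' : Type*} [TopologicalSpace M'] [ChartedSpace V' M']
  {E : Type u} [AddCommGroup E] [Module ℂ E] [TopologicalSpace E]
  [IsTopologicalAddGroup E] [ContinuousSMul ℂ E]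

omit [CompleteSpace V] in
theorem continuousAt_localParam (x : M) : ContinuousAt (localParam (V := V) x) 0 := by
  have h1 : ContinuousAt (fun h : V => extChartAt 𝓘(ℂ, V) x x + h) 0 := by fun_prop
  refine ContinuousAt.comp ?_ h1
  rw [add_zero]
  exact continuousAt_extChartAt_symm x

theorem IsHolomorphic.taylorAt_chart {f : M → E} (hf : IsHolomorphic V f) (x : M) :
    TaylorAt (fun y => f ((extChartAt 𝓘(ℂ, V) x).symm y)) (extChartAt 𝓘(ℂ, V) x x) := by
  obtain ⟨β, hβ⟩ := hf.2 x
  have h1 : TaylorAt (fun h : V => f (localParam x h)) 0 :=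
    taylorAt_of_hasSum (hf.1.continuousAt.comp (continuousAt_localParam x)) hβ
  set c := extChartAt 𝓘(ℂ, V) x x with hc
  have h2 : AnalyticAt ℂ (fun y : V => y - c) c := by fun_prop
  have h3 := TaylorAt.comp (φ := fun y : V => y - c) (x := c) (by simpa using h1) h2
  have h4 : (fun y => f (localParam x (y - c))) =
      fun y => f ((extChartAt 𝓘(ℂ, V) x).symm y) := by
    funext y
    simp only [localParam, ← hc, add_sub_cancel]
  rwa [h4] at h3

omit [CompleteSpace V'] [IsTopologicalAddGroup E] [ContinuousSMul ℂ E] in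
theorem taylorAt_comp_of_chart {f : M → E} {ψ : V' → M} {y : V'}
    (hf : TaylorAt (fun z => f ((extChartAt 𝓘(ℂ, V) (ψ y)).symm z))
      (extChartAt 𝓘(ℂ, V) (ψ y) (ψ y)))
    (hψ : ContMDiffAt 𝓘(ℂ, V') 𝓘(ℂ, V) ω ψ y) : TaylorAt (fun z => f (ψ z)) y := by
  have h1 : AnalyticAt ℂ (extChartAt 𝓘(ℂ, V) (ψ y) ∘ ψ) y :=
    (contMDiffAt_iff_contDiffAt.1 (contMDiffAt_iff_target.1 hψ).2).analyticAt
  refine (TaylorAt.comp (φ := extChartAt 𝓘(ℂ, V) (ψ y) ∘ ψ) hf h1).congr ?_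
  filter_upwards [hψ.continuousAt.preimage_mem_nhds
    (extChartAt_source_mem_nhds (I := 𝓘(ℂ, V)) (ψ y))] with z hz
  simp only [Function.comp_apply]
  rw [(extChartAt 𝓘(ℂ, V) (ψ y)).left_inv hz]

omit [CompleteSpace V'] in
theorem IsHolomorphic.taylorAt_comp {f : M → E} (hf : IsHolomorphic V f) {ψ : V' → M} {y : V'}
    (hψ : ContMDiffAt 𝓘(ℂ, V') 𝓘(ℂ, V) ω ψ y) : TaylorAt (fun z => f (ψ z)) y :=
  taylorAt_comp_of_chart (V := V) (hf.taylorAt_chart _) hψ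

omit [CompleteSpace V] [IsTopologicalAddGroup E] [ContinuousSMul ℂ E] in
theorem contMDiffAt_of_taylorAt_chart [IsManifold 𝓘(ℂ, V) ω M] {f : M → E} {x : M}
    (hf : TaylorAt (fun y => f ((extChartAt 𝓘(ℂ, V) x).symm y)) (extChartAt 𝓘(ℂ, V) x x))
    {B : Type u} [NormedAddCommGroup B] [NormedSpace ℂ B] [CompleteSpace B] (T : E →L[ℂ] B) :
    ContMDiffAt 𝓘(ℂ, V) 𝓘(ℂ, B) ω (fun y => T (f y)) x := by
  have h1 : ContMDiffAt 𝓘(ℂ, V) 𝓘(ℂ, B) ω (fun y => T (f ((extChartAt 𝓘(ℂ, V) x).symm y)))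
      (extChartAt 𝓘(ℂ, V) x x) := (hf.1 B T).contDiffAt.contMDiffAt
  refine (h1.comp x contMDiffAt_extChartAt).congr_of_eventuallyEq ?_
  filter_upwards [extChartAt_source_mem_nhds (I := 𝓘(ℂ, V)) x] with z hz
  simp only [Function.comp_apply]
  rw [(extChartAt 𝓘(ℂ, V) x).left_inv hz]

theorem IsHolomorphic.contMDiff [IsManifold 𝓘(ℂ, V) ω M] {f : M → E} (hf : IsHolomorphic V f)
    {B : Type u} [NormedAddCommGroup B] [NormedSpace ℂ B] [CompleteSpace B] (T : E →L[ℂ] B) :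
    ContMDiff 𝓘(ℂ, V) 𝓘(ℂ, B) ω (fun y => T (f y)) := fun x =>
  contMDiffAt_of_taylorAt_chart (hf.taylorAt_chart x) T

omit [CompleteSpace V] in
theorem contMDiffAt_localParam [IsManifold 𝓘(ℂ, V) ω M] (x : M) {h : V}
    (hh : extChartAt 𝓘(ℂ, V) x x + h ∈ (extChartAt 𝓘(ℂ, V) x).target) :
    ContMDiffAt 𝓘(ℂ, V) 𝓘(ℂ, V) ω (localParam (V := V) x) h := by
  have h1 : ContMDiffAt 𝓘(ℂ, V) 𝓘(ℂ, V) ω (fun h : V => extChartAt 𝓘(ℂ, V) x x + h) h :=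
    (contDiff_const.add contDiff_id).contMDiff.contMDiffAt
  exact ((contMDiffOn_extChartAt_symm x).contMDiffAt
    ((isOpen_extChartAt_target x).mem_nhds hh)).comp h h1

omit [CompleteSpace V] in
theorem contMDiffAt_localParam_zero [IsManifold 𝓘(ℂ, V) ω M] (x : M) :
    ContMDiffAt 𝓘(ℂ, V) 𝓘(ℂ, V) ω (localParam (V := V) x) 0 :=
  contMDiffAt_localParam x (by simp)

/-- The hypothesis concerns each chart only at its own centre. At another point `y` of the ball
around 0 it is carried over from the chart centred at `localParam x y` by the analytic change of
charts; then the Taylor series at 0 converges on the ball. -/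
theorem isHolomorphic_of_taylorAt [IsManifold 𝓘(ℂ, V) ω M] [LocallyConvexSpace ℝ E] [T2Space E]
    {f : M → E} (hf : ∀ x, TaylorAt (fun y => f ((extChartAt 𝓘(ℂ, V) x).symm y))
      (extChartAt 𝓘(ℂ, V) x x)) : IsHolomorphic V f := by
  refine ⟨continuous_of_forall_clm fun B _ _ _ T => ?_, fun x => ?_⟩
  · exact continuous_iff_continuousAt.2 fun x =>
      (contMDiffAt_of_taylorAt_chart (hf x) T).continuousAt
  · have h1 : ContinuousAt (fun h : V => extChartAt 𝓘(ℂ, V) x x + h) 0 := by fun_prop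
    have h2 := h1.preimage_mem_nhds (t := (extChartAt 𝓘(ℂ, V) x).target) (by
      rw [add_zero]
      exact extChartAt_target_mem_nhds x)
    obtain ⟨r, hr, hball⟩ := Metric.mem_nhds_iff.1 h2
    obtain ⟨β, hβ⟩ := exists_hasSum_of_taylorAt (f := fun h => f (localParam x h)) hr
      fun y hy => taylorAt_comp_of_chart (hf _) (contMDiffAt_localParam x (hball hy))
    exact ⟨β, Filter.mem_of_superset (Metric.ball_mem_nhds 0 hr) hβ⟩

/-- It suffices to check holomorphy in the parametrizations `localParam`. -/
theorem isHolomorphic_of_taylorAt_localParam [IsManifold 𝓘(ℂ, V) ω M] [LocallyConvexSpace ℝ E]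
    [T2Space E] {f : M → E} (hf : ∀ x, TaylorAt (fun h : V => f (localParam x h)) 0) :
    IsHolomorphic V f := by
  refine isHolomorphic_of_taylorAt fun x => ?_
  set c := extChartAt 𝓘(ℂ, V) x x with hc
  have h2 : AnalyticAt ℂ (fun y : V => y - c) c := by fun_prop
  have h3 := TaylorAt.comp (φ := fun y : V => y - c) (x := c) (by simpa using hf x) h2
  have h4 : (fun y => f (localParam x (y - c))) =
      fun y => f ((extChartAt 𝓘(ℂ, V) x).symm y) := by
    funext y
    simp only [localParam, ← hc, add_sub_cancel]
  rwa [h4] at h3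

theorem IsHolomorphic.comp_contMDiff [IsManifold 𝓘(ℂ, V') ω M']
    [LocallyConvexSpace ℝ E] [T2Space E] {f : M → E} (hf : IsHolomorphic V f) {ψ : M' → M}
    (hψ : ContMDiff 𝓘(ℂ, V') 𝓘(ℂ, V) ω ψ) : IsHolomorphic V' (fun y => f (ψ y)) :=
  isHolomorphic_of_taylorAt_localParam fun x => hf.taylorAt_comp
    ((hψ _).comp (0 : V') (contMDiffAt_localParam_zero x))

end Manifold

/-! ### Velocities of curves and the manifold derivative -/

section Velocity

variable {V : Type*} [NormedAddCommGroup V] [NormedSpace ℂ V] [CompleteSpace V]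
  {M : Type*} [TopologicalSpace M] [ChartedSpace V M]
  {E : Type u} [AddCommGroup E] [Module ℂ E] [TopologicalSpace E]

theorem hasVelocity_iff_hasDerivAt {B : Type*} [NormedAddCommGroup B] [NormedSpace ℂ B]
    {c : ℝ → B} {e : B} : HasVelocity c e ↔ HasDerivAt c e 0 := by
  rw [hasDerivAt_iff_tendsto_slope_zero, HasVelocity]
  simp only [zero_add, ← Complex.ofReal_inv, Complex.coe_smul]

theorem HasVelocity.clm_comp {B : Type*} [AddCommGroup B] [Module ℂ B] [TopologicalSpace B]
    {c : ℝ → E} {e : E} (h : HasVelocity c e) (T : E →L[ℂ] B) :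
    HasVelocity (fun t => T (c t)) (T e) := by
  refine ((T.continuous.tendsto e).comp h).congr fun t => ?_
  simp

theorem hasVelocity_of_forall_clm [IsTopologicalAddGroup E] [ContinuousSMul ℂ E]
    [LocallyConvexSpace ℝ E] {c : ℝ → E} {e : E}
    (h : ∀ (B : Type u) [NormedAddCommGroup B] [NormedSpace ℂ B] [CompleteSpace B]
      (T : E →L[ℂ] B), HasDerivAt (fun t => T (c t)) (T e) 0) : HasVelocity c e := by
  refine tendsto_of_forall_clm fun B _ _ _ T => ?_
  refine (hasVelocity_iff_hasDerivAt.2 (h B T)).congr fun t => ?_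
  simp

variable {B : Type*} [NormedAddCommGroup B] [NormedSpace ℂ B]

omit [CompleteSpace V] in
theorem _root_.MDifferentiableAt.hasFDerivAt_extChartAt_symm {F : M → B} {x : M}
    (hF : MDifferentiableAt 𝓘(ℂ, V) 𝓘(ℂ, B) F x) :
    HasFDerivAt (fun y => F ((extChartAt 𝓘(ℂ, V) x).symm y))
      (show V →L[ℂ] B from mfderiv 𝓘(ℂ, V) 𝓘(ℂ, B) F x) (extChartAt 𝓘(ℂ, V) x x) := by
  have h1 := hF.hasMFDerivAt.2
  simp only [writtenInExtChartAt, extChartAt_model_space_eq_id, modelWithCornersSelf_coe,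
    Set.range_id, PartialEquiv.refl_coe] at h1
  exact hasFDerivWithinAt_univ.1 h1

omit [CompleteSpace V] in
/-- The chain rule for a function on a complex manifold and a curve that is differentiable in the
preferred chart. -/
theorem hasDerivAt_comp_curve {F : M → B} {γ : ℝ → M} {t : ℝ} {v : V}
    (hF : MDifferentiableAt 𝓘(ℂ, V) 𝓘(ℂ, B) F (γ t)) (hγ : ContinuousAt γ t)
    (hγ' : HasDerivAt (fun s => extChartAt 𝓘(ℂ, V) (γ t) (γ s)) v t) :
    HasDerivAt (fun s => F (γ s)) (mfderiv 𝓘(ℂ, V) 𝓘(ℂ, B) F (γ t) v) t := by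
  have h1 := hF.hasFDerivAt_extChartAt_symm
  have h2 := (h1.restrictScalars ℝ).comp_hasDerivAt t hγ'
  refine h2.congr_of_eventuallyEq ?_
  filter_upwards [hγ.preimage_mem_nhds (extChartAt_source_mem_nhds (I := 𝓘(ℂ, V)) (γ t))]
    with s hs
  simp only [Function.comp_apply]
  rw [(extChartAt 𝓘(ℂ, V) (γ t)).left_inv hs]

omit [CompleteSpace V] in
theorem hasDerivAt_comp_localParam {F : M → B} {x : M}
    (hF : MDifferentiableAt 𝓘(ℂ, V) 𝓘(ℂ, B) F x) (v : V) :
    HasDerivAt (fun z : ℂ => F (localParam x (z • v))) (mfderiv 𝓘(ℂ, V) 𝓘(ℂ, B) F x v) 0 := by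
  have h1 := hF.hasFDerivAt_extChartAt_symm
  have h2 : HasDerivAt (fun z : ℂ => extChartAt 𝓘(ℂ, V) x x + z • v) v 0 := by
    simpa using ((hasDerivAt_id (0 : ℂ)).smul_const v).const_add (extChartAt 𝓘(ℂ, V) x x)
  have h3 : extChartAt 𝓘(ℂ, V) x x = extChartAt 𝓘(ℂ, V) x x + (0 : ℂ) • v := by simp
  rw [h3] at h1
  exact h1.comp_hasDerivAt (0 : ℂ) h2

theorem _root_.HasDerivAt.comp_ofReal' {c : ℂ → B} {e : B} (h : HasDerivAt c e 0) :
    HasDerivAt (fun t : ℝ => c t) e 0 := by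
  have h1 : HasFDerivAt c ((ContinuousLinearMap.toSpanSingleton ℂ e).restrictScalars ℝ)
      (Complex.ofRealCLM 0) := by
    simpa using h.hasFDerivAt.restrictScalars ℝ
  simpa [Function.comp_def] using h1.comp_hasDerivAt (0 : ℝ) Complex.ofRealCLM.hasDerivAt

/-- This links `tangent`, a limit in `E`, with `mfderiv`: after `T` both are the derivative of the
same real curve. -/
theorem clm_tangent [IsManifold 𝓘(ℂ, V) ω M] [IsTopologicalAddGroup E] [ContinuousSMul ℂ E]
    [LocallyConvexSpace ℝ E] [T2Space E] {f : M → E} (hf : IsHolomorphic V f) (x : M) (v : V)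
    {B : Type u} [NormedAddCommGroup B] [NormedSpace ℂ B] [CompleteSpace B] (T : E →L[ℂ] B) :
    T (tangent V f x v) = mfderiv 𝓘(ℂ, V) 𝓘(ℂ, B) (fun y => T (f y)) x v := by
  have h1 := hasVelocity_iff_hasDerivAt.1 ((hf.hasVelocity_tangent x v).clm_comp T)
  have h2 := hasDerivAt_comp_localParam
    ((hf.contMDiff T).mdifferentiable (by simp) x) v
  exact h1.unique h2.comp_ofReal'

end Velocity

/-! ### Symmetry of mixed derivatives -/

section Mixed

variable {B : Type*} [NormedAddCommGroup B] [NormedSpace ℂ B]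

/-- Mixed partial derivatives of an analytic function commute. -/
theorem mixed_deriv_eq {Ψ : ℂ × ℂ → B} (hΨ : AnalyticAt ℂ Ψ 0) {A A' : ℂ → B} {a a' : B}
    (hA : ∀ s, HasDerivAt (fun t => Ψ (s, t)) (A s) 0) (ha : HasDerivAt A a 0)
    (hA' : ∀ t, HasDerivAt (fun s => Ψ (s, t)) (A' t) 0) (ha' : HasDerivAt A' a' 0)
    [CompleteSpace B] : a = a' := by
  have hd : ∀ᶠ p in 𝓝 (0 : ℂ × ℂ), DifferentiableAt ℂ Ψ p :=
    hΨ.eventually_analyticAt.mono fun p hp => hp.differentiableAt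
  have h2 : HasFDerivAt (fderiv ℂ Ψ) (fderiv ℂ (fderiv ℂ Ψ) 0) 0 :=
    hΨ.fderiv.differentiableAt.hasFDerivAt
  have i1 : HasDerivAt (fun s : ℂ => ((s, 0) : ℂ × ℂ)) (1, 0) 0 :=
    (hasDerivAt_id (0 : ℂ)).prodMk (hasDerivAt_const 0 0)
  have i2 : HasDerivAt (fun t : ℂ => ((0, t) : ℂ × ℂ)) (0, 1) 0 :=
    (hasDerivAt_const 0 0).prodMk (hasDerivAt_id (0 : ℂ))
  have e1 : A =ᶠ[𝓝 0] fun s => fderiv ℂ Ψ (s, 0) (0, 1) := by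
    have := i1.continuousAt.eventually (p := fun p => DifferentiableAt ℂ Ψ p) hd
    filter_upwards [this] with s hs
    have j : HasDerivAt (fun t : ℂ => ((s, t) : ℂ × ℂ)) (0, 1) 0 :=
      (hasDerivAt_const 0 s).prodMk (hasDerivAt_id (0 : ℂ))
    exact (hA s).unique (hs.hasFDerivAt.comp_hasDerivAt (0 : ℂ) j)
  have e2 : A' =ᶠ[𝓝 0] fun t => fderiv ℂ Ψ (0, t) (1, 0) := by
    have := i2.continuousAt.eventually (p := fun p => DifferentiableAt ℂ Ψ p) hd
    filter_upwards [this] with t ht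
    have j : HasDerivAt (fun s : ℂ => ((s, t) : ℂ × ℂ)) (1, 0) 0 :=
      (hasDerivAt_id (0 : ℂ)).prodMk (hasDerivAt_const 0 t)
    exact (hA' t).unique (ht.hasFDerivAt.comp_hasDerivAt (0 : ℂ) j)
  have f1 : HasDerivAt A (fderiv ℂ (fderiv ℂ Ψ) 0 (1, 0) (0, 1)) 0 := by
    refine HasDerivAt.congr_of_eventuallyEq ?_ e1
    have := HasFDerivAt.comp_hasDerivAt (f := fun s : ℂ => ((s, 0) : ℂ × ℂ)) (0 : ℂ) h2 i1
    exact (ContinuousLinearMap.apply ℂ B ((0, 1) : ℂ × ℂ)).hasFDerivAt.comp_hasDerivAt (0 : ℂ) this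
  have f2 : HasDerivAt A' (fderiv ℂ (fderiv ℂ Ψ) 0 (0, 1) (1, 0)) 0 := by
    refine HasDerivAt.congr_of_eventuallyEq ?_ e2
    have := HasFDerivAt.comp_hasDerivAt (f := fun t : ℂ => ((0, t) : ℂ × ℂ)) (0 : ℂ) h2 i2
    exact (ContinuousLinearMap.apply ℂ B ((1, 0) : ℂ × ℂ)).hasFDerivAt.comp_hasDerivAt (0 : ℂ) this
  rw [ha.unique f1, ha'.unique f2]
  exact (hΨ.contDiffAt (n := ω)).isSymmSndFDerivAt (by simp) _ _

end Mixed

/-! ### Derivatives with respect to a complex parameter -/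

section Partial

variable {V : Type*} [NormedAddCommGroup V] [NormedSpace ℂ V] [CompleteSpace V]
  {M : Type*} [TopologicalSpace M] [ChartedSpace V M]
  {V' : Type*} [NormedAddCommGroup V'] [NormedSpace ℂ V'] [CompleteSpace V']
  {E : Type u} [AddCommGroup E] [Module ℂ E] [TopologicalSpace E]

omit [CompleteSpace V] in
theorem TaylorAt.exists_fderiv {f : V → E} {x : V} (v : V) (hf : ∀ᶠ y in 𝓝 x, TaylorAt f y) :
    ∃ g : V → E, TaylorAt g x ∧ ∀ᶠ y in 𝓝 x, ∀ (B : Type u) [NormedAddCommGroup B]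
      [NormedSpace ℂ B] [CompleteSpace B] (T : E →L[ℂ] B),
      HasFDerivAt (fun z => T (f z)) (fderiv ℂ (fun z => T (f z)) y) y ∧
      T (g y) = fderiv ℂ (fun z => T (f z)) y v := by
  have h1 : ∀ y, TaylorAt f y → ∃ e : E, ∀ (B : Type u) [NormedAddCommGroup B]
      [NormedSpace ℂ B] [CompleteSpace B] (T : E →L[ℂ] B),
      T e = fderiv ℂ (fun z => T (f z)) y v := by
    intro y hy
    obtain ⟨e, he⟩ := hy.2 1 (fun _ => v)
    refine ⟨e, fun B _ _ _ T => ?_⟩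
    rw [← he, iteratedFDeriv_one_apply]
  choose! g hg using h1
  refine ⟨g, (hf.self_of_nhds).fderiv_apply v fun B _ _ _ T => ?_, ?_⟩
  · filter_upwards [hf] with y hy using hg y hy B T
  · filter_upwards [hf] with y hy B _ _ _ T
    exact ⟨(hy.1 B T).differentiableAt.hasFDerivAt, hg y hy B T⟩

variable [IsTopologicalAddGroup E] [ContinuousSMul ℂ E] [LocallyConvexSpace ℝ E] [T2Space E]

/-- Here `u` is the derivative of `f ∘ μ` in the direction `(1, 0)`, restricted to `{0} × V'`; both
operations preserve `TaylorAt`. Applied to products in a group, this shows that invariant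
derivatives of holomorphic maps are holomorphic. -/
theorem IsHolomorphic.taylorAt_partial {f : M → E} (hf : IsHolomorphic V f) {μ : ℂ × V' → M}
    (hμ : ∀ᶠ y in 𝓝 (0 : ℂ × V'), ContMDiffAt 𝓘(ℂ, ℂ × V') 𝓘(ℂ, V) ω μ y) {u : V' → E}
    (hu : ∀ (h : V') (B : Type u) [NormedAddCommGroup B] [NormedSpace ℂ B]
      [CompleteSpace B] (T : E →L[ℂ] B),
      HasDerivAt (fun z : ℂ => T (f (μ (z, h)))) (T (u h)) 0) : TaylorAt u 0 := by
  obtain ⟨g, hg, hg'⟩ := TaylorAt.exists_fderiv (f := fun y => f (μ y)) (x := 0) ((1, 0) : ℂ × V')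
    (hμ.mono fun y hy => hf.taylorAt_comp hy)
  have ha : AnalyticAt ℂ (fun h : V' => ((0, h) : ℂ × V')) 0 := by fun_prop
  refine (TaylorAt.comp (φ := fun h : V' => ((0, h) : ℂ × V')) hg ha).congr ?_
  filter_upwards [ha.continuousAt.eventually hg'] with h hh
  refine eq_of_forall_clm fun B _ _ _ T => ?_
  obtain ⟨h1, h2⟩ := hh B T
  have j : HasDerivAt (fun z : ℂ => ((z, h) : ℂ × V')) (1, 0) 0 :=
    (hasDerivAt_id (0 : ℂ)).prodMk (hasDerivAt_const 0 h)
  rw [h2]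
  exact (HasFDerivAt.comp_hasDerivAt (f := fun z : ℂ => ((z, h) : ℂ × V')) (0 : ℂ) h1 j).unique
    (hu h B T)

end Partial

/-! ### Invariant vector fields acting on holomorphic maps -/

section Group

variable {V : Type*} [NormedAddCommGroup V] [NormedSpace ℂ V]
  {G : Type*} [TopologicalSpace G] [ChartedSpace V G] [Group G]
  {E : Type u} [AddCommGroup E] [Module ℂ E] [TopologicalSpace E]
  [IsTopologicalAddGroup E] [ContinuousSMul ℂ E]

variable (V) in
/-- The action of the left invariant vector field with value `x` at `1` on functions. -/
def leftInvDeriv (x : GroupLieAlgebra 𝓘(ℂ, V) G) (f : G → E) (g : G) : E :=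
  tangent V (fun h => f (g * h)) 1 x

variable [CompleteSpace V] [LieGroup 𝓘(ℂ, V) ω G] [LocallyConvexSpace ℝ E] [T2Space E]
  {f : G → E}

theorem IsHolomorphic.mul_left (hf : IsHolomorphic V f) (g : G) :
    IsHolomorphic V (fun h => f (g * h)) :=
  hf.comp_contMDiff (contMDiff_mul_left (I := 𝓘(ℂ, V)) (n := ω) (a := g))

theorem IsHolomorphic.mul_right (hf : IsHolomorphic V f) (g : G) :
    IsHolomorphic V (fun h => f (h * g)) :=
  hf.comp_contMDiff (contMDiff_mul_right (I := 𝓘(ℂ, V)) (n := ω) (a := g))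

theorem IsHolomorphic.comp_inv (hf : IsHolomorphic V f) : IsHolomorphic V (fun h => f h⁻¹) :=
  hf.comp_contMDiff (contMDiff_inv 𝓘(ℂ, V) ω)

variable {B : Type u} [NormedAddCommGroup B] [NormedSpace ℂ B] [CompleteSpace B]

theorem IsHolomorphic.hasDerivAt_tangent (hf : IsHolomorphic V f) (g : G) (v : V)
    (T : E →L[ℂ] B) :
    HasDerivAt (fun z : ℂ => T (f (localParam g (z • v)))) (T (tangent V f g v)) 0 := by
  rw [clm_tangent hf]
  exact hasDerivAt_comp_localParam ((hf.contMDiff T).mdifferentiable (by simp) g) v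

theorem IsHolomorphic.hasDerivAt_leftInvDeriv (hf : IsHolomorphic V f)
    (x : GroupLieAlgebra 𝓘(ℂ, V) G) (g : G) (T : E →L[ℂ] B) :
    HasDerivAt (fun z : ℂ => T (f (g * localParam (1 : G) (z • (show V from x)))))
      (T (leftInvDeriv V x f g)) 0 :=
  (hf.mul_left g).hasDerivAt_tangent 1 x T

theorem IsHolomorphic.hasDerivAt_rightInvDeriv (hf : IsHolomorphic V f)
    (x : GroupLieAlgebra 𝓘(ℂ, V) G) (g : G) (T : E →L[ℂ] B) :
    HasDerivAt (fun z : ℂ => T (f (localParam (1 : G) (z • (show V from x)) * g)))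
      (T (rightInvDeriv V x f g)) 0 :=
  (hf.mul_right g).hasDerivAt_tangent 1 x T

omit [CompleteSpace V] in
theorem eventually_contMDiffAt_localParam (g : G) :
    ∀ᶠ h in 𝓝 (0 : V), ContMDiffAt 𝓘(ℂ, V) 𝓘(ℂ, V) ω (localParam (V := V) g) h := by
  have h1 : ContinuousAt (fun h : V => extChartAt 𝓘(ℂ, V) g g + h) 0 := by fun_prop
  have h2 := h1.preimage_mem_nhds (t := (extChartAt 𝓘(ℂ, V) g).target) (by
    rw [add_zero]
    exact extChartAt_target_mem_nhds g)
  filter_upwards [h2] with h hh using contMDiffAt_localParam g hh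

omit [CompleteSpace V] in
theorem eventually_contMDiffAt_localParam_fst (v : V) : ∀ᶠ y in 𝓝 (0 : ℂ × V),
    ContMDiffAt 𝓘(ℂ, ℂ × V) 𝓘(ℂ, V) ω (fun y : ℂ × V => localParam (V := V) (1 : G) (y.1 • v)) y := by
  have h1 : ContDiff ℂ ω (fun y : ℂ × V => y.1 • v) := by fun_prop
  have h2 := h1.continuous.tendsto 0
  simp only [Prod.fst_zero, zero_smul] at h2
  filter_upwards [h2.eventually (eventually_contMDiffAt_localParam (1 : G))] with y hy
  exact ContMDiffAt.comp (g := localParam (V := V) (1 : G)) (f := fun y : ℂ × V => y.1 • v) y hy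
    h1.contMDiff.contMDiffAt

omit [CompleteSpace V] in
theorem eventually_contMDiffAt_localParam_snd (g : G) : ∀ᶠ y in 𝓝 (0 : ℂ × V),
    ContMDiffAt 𝓘(ℂ, ℂ × V) 𝓘(ℂ, V) ω (fun y : ℂ × V => localParam (V := V) g y.2) y := by
  have h1 : ContDiff ℂ ω (fun y : ℂ × V => y.2) := by fun_prop
  have h2 := h1.continuous.tendsto 0
  simp only [Prod.snd_zero] at h2
  filter_upwards [h2.eventually (eventually_contMDiffAt_localParam g)] with y hy
  exact hy.comp y h1.contMDiff.contMDiffAt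

/-- Near `g` this is the `z`-derivative at 0 of `f` at the product of `localParam g h` and
`localParam 1 (z • x)`, which depends analytically on `(z, h)`. -/
theorem IsHolomorphic.leftInvDeriv (hf : IsHolomorphic V f)
    (x : GroupLieAlgebra 𝓘(ℂ, V) G) : IsHolomorphic V (leftInvDeriv V x f) := by
  refine isHolomorphic_of_taylorAt_localParam fun g => ?_
  refine hf.taylorAt_partial
    (μ := fun y : ℂ × V => localParam g y.2 * localParam (1 : G) (y.1 • (show V from x))) ?_
    fun h B _ _ _ T => hf.hasDerivAt_leftInvDeriv x (localParam g h) T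
  filter_upwards [eventually_contMDiffAt_localParam_snd g,
    eventually_contMDiffAt_localParam_fst (G := G) (show V from x)] with y h1 h2
  exact h1.mul h2

theorem IsHolomorphic.rightInvDeriv (hf : IsHolomorphic V f)
    (x : GroupLieAlgebra 𝓘(ℂ, V) G) : IsHolomorphic V (rightInvDeriv V x f) := by
  refine isHolomorphic_of_taylorAt_localParam fun g => ?_
  refine hf.taylorAt_partial
    (μ := fun y : ℂ × V => localParam (1 : G) (y.1 • (show V from x)) * localParam g y.2) ?_
    fun h B _ _ _ T => hf.hasDerivAt_rightInvDeriv x (localParam g h) T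
  filter_upwards [eventually_contMDiffAt_localParam_snd g,
    eventually_contMDiffAt_localParam_fst (G := G) (show V from x)] with y h1 h2
  exact h2.mul h1

/-- Left invariant and right invariant vector fields commute. -/
theorem leftInvDeriv_rightInvDeriv (hf : IsHolomorphic V f)
    (x y : GroupLieAlgebra 𝓘(ℂ, V) G) :
    leftInvDeriv V x (rightInvDeriv V y f) = rightInvDeriv V y (leftInvDeriv V x f) := by
  funext g
  refine eq_of_forall_clm fun B _ _ _ T => ?_
  set c : V → ℂ → G := fun v z => localParam (1 : G) (z • v)
  have hc : ∀ v, ContMDiffAt 𝓘(ℂ, ℂ) 𝓘(ℂ, V) ω (c v) 0 := fun v => by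
    have h1 : ContDiff ℂ ω (fun z : ℂ => z • v) := by fun_prop
    refine ContMDiffAt.comp (g := localParam (V := V) (1 : G)) (f := fun z : ℂ => z • v) (0 : ℂ) ?_
      h1.contMDiff.contMDiffAt
    rw [zero_smul]
    exact contMDiffAt_localParam_zero _
  have h0 : ContMDiffAt 𝓘(ℂ, ℂ × ℂ) 𝓘(ℂ, V) ω (fun p : ℂ × ℂ => c y p.2 * g * c x p.1) 0 := by
    have h1 : ContMDiffAt 𝓘(ℂ, ℂ × ℂ) 𝓘(ℂ, V) ω (fun p : ℂ × ℂ => c x p.1) 0 :=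
      ContMDiffAt.comp (g := c x) (f := Prod.fst) (0 : ℂ × ℂ) (hc x) contDiff_fst.contMDiff.contMDiffAt
    have h2 : ContMDiffAt 𝓘(ℂ, ℂ × ℂ) 𝓘(ℂ, V) ω (fun p : ℂ × ℂ => c y p.2) 0 :=
      ContMDiffAt.comp (g := c y) (f := Prod.snd) (0 : ℂ × ℂ) (hc y) contDiff_snd.contMDiff.contMDiffAt
    exact (h2.mul contMDiffAt_const).mul h1
  -- Left and right multiplication involve separate variables, so the two sides are the two mixed
  -- derivatives of one function.
  refine mixed_deriv_eq (Ψ := fun p : ℂ × ℂ => T (f (c y p.2 * g * c x p.1)))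
    (A := fun s => T (rightInvDeriv V y f (g * c x s)))
    (A' := fun t => T (leftInvDeriv V x f (c y t * g)))
    ((hf.taylorAt_comp h0).1 B T) (fun s => ?_) ?_ (fun t => ?_) ?_
  · simpa only [mul_assoc] using hf.hasDerivAt_rightInvDeriv y (g * c x s) T
  · exact (hf.rightInvDeriv y).hasDerivAt_leftInvDeriv x g T
  · exact hf.hasDerivAt_leftInvDeriv x (c y t * g) T
  · exact (hf.leftInvDeriv x).hasDerivAt_rightInvDeriv y g T

omit [IsTopologicalAddGroup E] [ContinuousSMul ℂ E] [CompleteSpace V] [LieGroup 𝓘(ℂ, V) ω G]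
  [LocallyConvexSpace ℝ E] [T2Space E] in
theorem leftInvDeriv_one (x : GroupLieAlgebra 𝓘(ℂ, V) G) (f : G → E) :
    leftInvDeriv V x f 1 = rightInvDeriv V x f 1 := by
  simp only [HolInd.leftInvDeriv, HolInd.rightInvDeriv, one_mul, mul_one]

omit [IsTopologicalAddGroup E] [ContinuousSMul ℂ E] [CompleteSpace V] [LieGroup 𝓘(ℂ, V) ω G]
  [LocallyConvexSpace ℝ E] [T2Space E] in
theorem leftInvDeriv_comp_mul_left (x : GroupLieAlgebra 𝓘(ℂ, V) G) (f : G → E) (a : G) :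
    leftInvDeriv V x (fun h => f (a * h)) = fun g => leftInvDeriv V x f (a * g) := by
  funext g
  simp only [HolInd.leftInvDeriv, mul_assoc]

end Group

/-! ### Brackets of vector fields as commutators of derivations -/

section Bracket

open VectorField

variable {V : Type*} [NormedAddCommGroup V] [NormedSpace ℂ V] [CompleteSpace V]
  {M : Type*} [TopologicalSpace M] [ChartedSpace V M] [IsManifold 𝓘(ℂ, V) ω M]
  {B : Type*} [NormedAddCommGroup B] [NormedSpace ℂ B]

/-- The representation of a vector field in the preferred chart at `x`. -/
def chartField (x : M) (X : Π p : M, TangentSpace 𝓘(ℂ, V) p) : V → V :=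
  mpullbackWithin 𝓘(ℂ, V) 𝓘(ℂ, V) (extChartAt 𝓘(ℂ, V) x).symm X Set.univ

-- The differential of the inverse chart carries `chartField x X` back to `X`, so the chain rule
-- moves the derivation `X` into the chart.
omit [CompleteSpace V] in
theorem fderiv_chartField {F : M → B} (x : M) (X : Π p : M, TangentSpace 𝓘(ℂ, V) p) {y : V}
    (hy : y ∈ (extChartAt 𝓘(ℂ, V) x).target)
    (hF : MDifferentiableAt 𝓘(ℂ, V) 𝓘(ℂ, B) F ((extChartAt 𝓘(ℂ, V) x).symm y)) :
    fderiv ℂ (fun z => F ((extChartAt 𝓘(ℂ, V) x).symm z)) y (chartField x X y) =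
      (show B from mfderiv 𝓘(ℂ, V) 𝓘(ℂ, B) F ((extChartAt 𝓘(ℂ, V) x).symm y)
        (X ((extChartAt 𝓘(ℂ, V) x).symm y))) := by
  set e := extChartAt 𝓘(ℂ, V) x
  have hinv := isInvertible_mfderivWithin_extChartAt_symm (I := 𝓘(ℂ, V)) hy
  have hsymm : MDifferentiableAt 𝓘(ℂ, V) 𝓘(ℂ, V) e.symm y :=
    (((contMDiffOn_extChartAt_symm (n := ω) x).contMDiffAt
      ((isOpen_extChartAt_target x).mem_nhds hy))).mdifferentiableAt (by simp)
  have h1 : mfderiv 𝓘(ℂ, V) 𝓘(ℂ, B) (F ∘ e.symm) y =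
      (mfderiv 𝓘(ℂ, V) 𝓘(ℂ, B) F (e.symm y)).comp (mfderiv 𝓘(ℂ, V) 𝓘(ℂ, V) e.symm y) :=
    mfderiv_comp y hF hsymm
  rw [mfderiv_eq_fderiv] at h1
  have h2 : (mfderivWithin 𝓘(ℂ, V) 𝓘(ℂ, V) e.symm Set.univ y) =
      mfderiv 𝓘(ℂ, V) 𝓘(ℂ, V) e.symm y := by
    simp [mfderivWithin_univ]
  rw [modelWithCornersSelf_coe, Set.range_id, h2] at hinv
  have h3 : mfderiv 𝓘(ℂ, V) 𝓘(ℂ, V) e.symm y (chartField (V := V) x X y) = X (e.symm y) := by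
    have h5 : chartField (V := V) x X y =
        (mfderiv 𝓘(ℂ, V) 𝓘(ℂ, V) e.symm y).inverse (X (e.symm y)) := by
      rw [← h2]
      rfl
    rw [h5]
    exact DFunLike.congr_fun hinv.self_comp_inverse (X (e.symm y))
  have h4 := DFunLike.congr_fun h1 (chartField (V := V) x X y)
  refine h4.trans ?_
  exact congrArg (mfderiv 𝓘(ℂ, V) 𝓘(ℂ, B) F (e.symm y)) h3

theorem differentiableAt_chartField (x : M) {X : Π p : M, TangentSpace 𝓘(ℂ, V) p}
    (hX : MDifferentiableAt 𝓘(ℂ, V) 𝓘(ℂ, V).tangent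
      (fun p => (X p : TangentBundle 𝓘(ℂ, V) M)) x) :
    DifferentiableAt ℂ (chartField x X) (extChartAt 𝓘(ℂ, V) x x) := by
  have := IsManifold.of_le (I := 𝓘(ℂ, V)) (M := M) (m := 2) (n := ω) le_top
  have h := (mdifferentiableWithinAt_univ.2 hX).differentiableWithinAt_mpullbackWithin_vectorField
  rw [Set.preimage_univ, Set.univ_inter, modelWithCornersSelf_coe, Set.range_id] at h
  exact differentiableWithinAt_univ.1 h

/-- The Lie bracket of vector fields is the commutator of derivations. -/
theorem mfderiv_mlieBracket {F : M → B} (hF : ContMDiff 𝓘(ℂ, V) 𝓘(ℂ, B) ω F) {x : M}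
    {X Y : Π p : M, TangentSpace 𝓘(ℂ, V) p}
    (hX : MDifferentiableAt 𝓘(ℂ, V) 𝓘(ℂ, V).tangent
      (fun p => (X p : TangentBundle 𝓘(ℂ, V) M)) x)
    (hY : MDifferentiableAt 𝓘(ℂ, V) 𝓘(ℂ, V).tangent
      (fun p => (Y p : TangentBundle 𝓘(ℂ, V) M)) x)
    {XF YF : M → B} (hXF : ∀ p, XF p = mfderiv 𝓘(ℂ, V) 𝓘(ℂ, B) F p (X p))
    (hYF : ∀ p, YF p = mfderiv 𝓘(ℂ, V) 𝓘(ℂ, B) F p (Y p))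
    (hXF' : MDifferentiableAt 𝓘(ℂ, V) 𝓘(ℂ, B) XF x)
    (hYF' : MDifferentiableAt 𝓘(ℂ, V) 𝓘(ℂ, B) YF x) [CompleteSpace B] :
    (show B from mfderiv 𝓘(ℂ, V) 𝓘(ℂ, B) F x (mlieBracket 𝓘(ℂ, V) X Y x)) =
      (show B from mfderiv 𝓘(ℂ, V) 𝓘(ℂ, B) YF x (X x)) -
        (show B from mfderiv 𝓘(ℂ, V) 𝓘(ℂ, B) XF x (Y x)) := by
  set e := extChartAt 𝓘(ℂ, V) x with he
  set c := e x with hc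
  have hct : c ∈ e.target := mem_extChartAt_target x
  have hec : e.symm c = x := extChartAt_to_inv x
  set F' : V → B := fun z => F (e.symm z) with hF'
  have hFd : ∀ p, MDifferentiableAt 𝓘(ℂ, V) 𝓘(ℂ, B) F p := hF.mdifferentiable (by simp)
  have hF'a : AnalyticAt ℂ F' c := by
    have h1 : ContMDiffAt 𝓘(ℂ, V) 𝓘(ℂ, B) ω F' c := hF.contMDiffAt.comp c
      ((contMDiffOn_extChartAt_symm (n := ω) x).contMDiffAt
        ((isOpen_extChartAt_target x).mem_nhds hct))
    exact (contMDiffAt_iff_contDiffAt.1 h1).analyticAt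
  have hdd : DifferentiableAt ℂ (fderiv ℂ F') c := hF'a.fderiv.differentiableAt
  -- The product rule in the chart: `Z(WF) = D²F'(Z, W) + DF'(DW · Z)`. In the commutator the
  -- symmetric second derivatives cancel, and the first-order terms form the bracket.
  have key : ∀ (Z W : Π p : M, TangentSpace 𝓘(ℂ, V) p) (WF : M → B),
      DifferentiableAt ℂ (chartField x W) c →
      (∀ p, WF p = mfderiv 𝓘(ℂ, V) 𝓘(ℂ, B) F p (W p)) →
      MDifferentiableAt 𝓘(ℂ, V) 𝓘(ℂ, B) WF x →
      (show B from mfderiv 𝓘(ℂ, V) 𝓘(ℂ, B) WF x (Z x)) =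
        fderiv ℂ (fderiv ℂ F') c (chartField x Z c) (chartField x W c) +
        fderiv ℂ F' c (fderiv ℂ (chartField x W) c (chartField x Z c)) := by
    intro Z W WF hW hWF hWF'
    have h1 := fderiv_chartField (F := WF) x Z hct (by rw [hec]; exact hWF')
    have h2 : (fun z => WF (e.symm z)) =ᶠ[𝓝 c] fun z => fderiv ℂ F' z (chartField x W z) := by
      filter_upwards [(isOpen_extChartAt_target x).mem_nhds hct] with z hz
      rw [fderiv_chartField x W hz (hFd _), hWF]
    rw [h2.fderiv_eq, fderiv_clm_apply hdd hW] at h1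
    rw [hec] at h1
    rw [← h1]
    simp [add_comm]
  rw [key X Y YF (differentiableAt_chartField x hY) hYF hYF',
    key Y X XF (differentiableAt_chartField x hX) hXF hXF']
  have hsymm : fderiv ℂ (fderiv ℂ F') c (chartField x X c) (chartField x Y c) =
      fderiv ℂ (fderiv ℂ F') c (chartField x Y c) (chartField x X c) :=
    (hF'a.contDiffAt (n := ω)).isSymmSndFDerivAt (by simp) _ _
  rw [hsymm, add_sub_add_left_eq_sub, ← map_sub]
  have hbr : mlieBracket 𝓘(ℂ, V) X Y x = (mfderiv 𝓘(ℂ, V) 𝓘(ℂ, V) e x).inverse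
      (lieBracket (E := V) ℂ (chartField (V := V) x X) (chartField (V := V) x Y) c) := by
    rw [← lieBracketWithin_univ, ← mlieBracketWithin_univ, mlieBracketWithin_apply,
      Set.preimage_univ, Set.univ_inter, modelWithCornersSelf_coe, Set.range_id]
    rfl
  have hchain : mfderiv 𝓘(ℂ, V) 𝓘(ℂ, B) F x =
      (fderiv ℂ F' c).comp (mfderiv 𝓘(ℂ, V) 𝓘(ℂ, V) e x) := by
    have h1 : F =ᶠ[𝓝 x] F' ∘ e := by
      filter_upwards [extChartAt_source_mem_nhds (I := 𝓘(ℂ, V)) x] with z hz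
      simp only [Function.comp_apply, hF']
      rw [e.left_inv hz]
    have h2 : MDifferentiableAt 𝓘(ℂ, V) 𝓘(ℂ, B) F' (e x) :=
      hF'a.differentiableAt.mdifferentiableAt
    rw [h1.mfderiv_eq, mfderiv_comp x h2 (mdifferentiableAt_extChartAt (mem_chart_source V x)),
      mfderiv_eq_fderiv, ← hc]
    rfl
  have hinv := isInvertible_mfderiv_extChartAt (I := 𝓘(ℂ, V)) (mem_extChartAt_source x)
  rw [hbr, hchain]
  have h3 := DFunLike.congr_fun hinv.self_comp_inverse
    (lieBracket (E := V) ℂ (chartField (V := V) x X) (chartField (V := V) x Y) c)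
  exact congrArg (fderiv ℂ F' c) h3

end Bracket

/-! ### Left invariant derivatives form a Lie algebra action -/

section Group

variable {V : Type*} [NormedAddCommGroup V] [NormedSpace ℂ V] [CompleteSpace V]
  {G : Type*} [TopologicalSpace G] [ChartedSpace V G] [Group G] [LieGroup 𝓘(ℂ, V) ω G]
  {E : Type u} [AddCommGroup E] [Module ℂ E] [TopologicalSpace E]
  [IsTopologicalAddGroup E] [ContinuousSMul ℂ E] [LocallyConvexSpace ℝ E] [T2Space E]
  {f : G → E} {B : Type u} [NormedAddCommGroup B] [NormedSpace ℂ B] [CompleteSpace B]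

theorem clm_leftInvDeriv (hf : IsHolomorphic V f) (x : GroupLieAlgebra 𝓘(ℂ, V) G) (g : G)
    (T : E →L[ℂ] B) : T (leftInvDeriv V x f g) =
      mfderiv 𝓘(ℂ, V) 𝓘(ℂ, B) (fun h => T (f h)) g (mulInvariantVectorField x g) := by
  have h1 : T (leftInvDeriv V x f g) =
      mfderiv 𝓘(ℂ, V) 𝓘(ℂ, B) (fun h => T (f (g * h))) 1 x := clm_tangent (hf.mul_left g) 1 x T
  have hm : MDifferentiableAt 𝓘(ℂ, V) 𝓘(ℂ, V) (fun h => g * h) 1 :=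
    (contMDiff_mul_left (I := 𝓘(ℂ, V)) (n := ω) (a := g)).mdifferentiable (by simp) 1
  have h2 := mfderiv_comp (I' := 𝓘(ℂ, V)) (I'' := 𝓘(ℂ, B)) (g := fun h => T (f h)) (1 : G)
    ((hf.contMDiff T).mdifferentiable (by simp) _) hm
  rw [h1]
  have h3 := DFunLike.congr_fun h2 x
  refine h3.trans ?_
  -- The base point `g * 1` occurs in the type of the derivative; all tangent spaces are read as `V`
  -- before it is replaced by `g`.
  have h4 : ∀ g' : G, g' = g → (show V →L[ℂ] B from mfderiv 𝓘(ℂ, V) 𝓘(ℂ, B) (fun h => T (f h)) g') =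
      (show V →L[ℂ] B from mfderiv 𝓘(ℂ, V) 𝓘(ℂ, B) (fun h => T (f h)) g) := by
    rintro _ rfl
    rfl
  exact DFunLike.congr_fun (h4 (g * 1) (mul_one g)) _

/-- `GroupLieAlgebra` takes its bracket from left invariant fields, so these give a homomorphism,
not an anti-homomorphism. Therefore the left operators extend to `U(𝔤)` by its universal property.
-/
theorem leftInvDeriv_lie (hf : IsHolomorphic V f) (x y : GroupLieAlgebra 𝓘(ℂ, V) G) (g : G) :
    leftInvDeriv V ⁅x, y⁆ f g =
      leftInvDeriv V x (leftInvDeriv V y f) g - leftInvDeriv V y (leftInvDeriv V x f) g := by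
  refine eq_of_forall_clm fun B _ _ _ T => ?_
  rw [map_sub, clm_leftInvDeriv hf, clm_leftInvDeriv (hf.leftInvDeriv y),
    clm_leftInvDeriv (hf.leftInvDeriv x), GroupLieAlgebra.bracket_def,
    mulInvariantVector_mlieBracket]
  exact mfderiv_mlieBracket (hf.contMDiff T) (mdifferentiableAt_mulInvariantVectorField x)
    (mdifferentiableAt_mulInvariantVectorField y) (fun p => clm_leftInvDeriv hf x p T)
    (fun p => clm_leftInvDeriv hf y p T)
    (((hf.leftInvDeriv x).contMDiff T).mdifferentiable (by simp) g)
    (((hf.leftInvDeriv y).contMDiff T).mdifferentiable (by simp) g)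

theorem leftInvDeriv_add_vec (hf : IsHolomorphic V f) (x y : GroupLieAlgebra 𝓘(ℂ, V) G) (g : G) :
    leftInvDeriv V (x + y) f g = leftInvDeriv V x f g + leftInvDeriv V y f g := by
  refine eq_of_forall_clm fun B _ _ _ T => ?_
  rw [map_add, clm_leftInvDeriv hf, clm_leftInvDeriv hf, clm_leftInvDeriv hf,
    mulInvariantVectorField_add]
  exact map_add _ _ _

theorem leftInvDeriv_smul_vec (hf : IsHolomorphic V f) (a : ℂ) (x : GroupLieAlgebra 𝓘(ℂ, V) G)
    (g : G) : leftInvDeriv V (a • x) f g = a • leftInvDeriv V x f g := by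
  refine eq_of_forall_clm fun B _ _ _ T => ?_
  rw [map_smul, clm_leftInvDeriv hf, clm_leftInvDeriv hf, mulInvariantVectorField_smul]
  exact map_smul _ _ _

end Group

/-! ### Words in invariant vector fields -/

section Words

variable {V : Type*} [NormedAddCommGroup V] [NormedSpace ℂ V]
  {G : Type*} [TopologicalSpace G] [ChartedSpace V G] [Group G]
  {E : Type u} [AddCommGroup E] [Module ℂ E] [TopologicalSpace E]

variable (V) in
/-- The action of the left invariant differential operator `x₁ ⋯ xₙ` on functions. -/
def leftInvDiffOp (D : List (GroupLieAlgebra 𝓘(ℂ, V) G)) (f : G → E) : G → E :=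
  D.foldr (fun x F => leftInvDeriv V x F) f

theorem leftInvDiffOp_nil (f : G → E) : leftInvDiffOp V [] f = f := rfl

theorem leftInvDiffOp_cons (x : GroupLieAlgebra 𝓘(ℂ, V) G)
    (D : List (GroupLieAlgebra 𝓘(ℂ, V) G)) (f : G → E) :
    leftInvDiffOp V (x :: D) f = leftInvDeriv V x (leftInvDiffOp V D f) := rfl

theorem leftInvDiffOp_concat (x : GroupLieAlgebra 𝓘(ℂ, V) G)
    (D : List (GroupLieAlgebra 𝓘(ℂ, V) G)) (f : G → E) :
    leftInvDiffOp V (D ++ [x]) f = leftInvDiffOp V D (leftInvDeriv V x f) := by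
  simp [leftInvDiffOp]

theorem rightInvDiffOp_cons (x : GroupLieAlgebra 𝓘(ℂ, V) G)
    (D : List (GroupLieAlgebra 𝓘(ℂ, V) G)) (f : G → E) :
    rightInvDiffOp V (x :: D) f = rightInvDiffOp V D (rightInvDeriv V x f) := rfl

theorem rightInvDiffOp_concat (x : GroupLieAlgebra 𝓘(ℂ, V) G)
    (D : List (GroupLieAlgebra 𝓘(ℂ, V) G)) (f : G → E) :
    rightInvDiffOp V (D ++ [x]) f = rightInvDeriv V x (rightInvDiffOp V D f) := by
  simp [rightInvDiffOp]

theorem leftInvDiffOp_comp_mul_left (D : List (GroupLieAlgebra 𝓘(ℂ, V) G)) (f : G → E) (a : G) :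
    leftInvDiffOp V D (fun h => f (a * h)) = fun g => leftInvDiffOp V D f (a * g) := by
  induction D with
  | nil => rfl
  | cons x D ih => rw [leftInvDiffOp_cons, ih, leftInvDeriv_comp_mul_left, leftInvDiffOp_cons]

variable [IsTopologicalAddGroup E] [ContinuousSMul ℂ E]
  [CompleteSpace V] [LieGroup 𝓘(ℂ, V) ω G] [LocallyConvexSpace ℝ E] [T2Space E]
  {f : G → E}

theorem IsHolomorphic.leftInvDiffOp (hf : IsHolomorphic V f)
    (D : List (GroupLieAlgebra 𝓘(ℂ, V) G)) : IsHolomorphic V (leftInvDiffOp V D f) := by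
  induction D with
  | nil => exact hf
  | cons x D ih => exact ih.leftInvDeriv x

theorem leftInvDiffOp_rightInvDeriv (hf : IsHolomorphic V f)
    (D : List (GroupLieAlgebra 𝓘(ℂ, V) G)) (x : GroupLieAlgebra 𝓘(ℂ, V) G) :
    leftInvDiffOp V D (rightInvDeriv V x f) = rightInvDeriv V x (leftInvDiffOp V D f) := by
  induction D with
  | nil => rfl
  | cons y D ih =>
    rw [leftInvDiffOp_cons, ih, leftInvDeriv_rightInvDeriv (hf.leftInvDiffOp D),
      leftInvDiffOp_cons]

/-- The first letter acts innermost among the right derivatives. It commutes with the left operator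
formed from the remaining letters, so it can be moved outermost, where at 1 it becomes a left
derivative. This accounts for the opposite orders of composition. -/
theorem rightInvDiffOp_one (hf : IsHolomorphic V f) (D : List (GroupLieAlgebra 𝓘(ℂ, V) G)) :
    rightInvDiffOp V D f 1 = leftInvDiffOp V D f 1 := by
  induction D generalizing f with
  | nil => rfl
  | cons x D ih =>
    rw [rightInvDiffOp_cons, ih (hf.rightInvDeriv x), leftInvDiffOp_rightInvDeriv hf,
      leftInvDiffOp_cons, leftInvDeriv_one]

end Words

/-! ### The identity theorem -/

section Identity

variable {V : Type*} [NormedAddCommGroup V] [NormedSpace ℂ V] [CompleteSpace V]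
  {G : Type*} [TopologicalSpace G] [ChartedSpace V G] [Group G] [LieGroup 𝓘(ℂ, V) ω G]
  {E : Type u} [AddCommGroup E] [Module ℂ E] [TopologicalSpace E]
  [IsTopologicalAddGroup E] [ContinuousSMul ℂ E] [LocallyConvexSpace ℝ E] [T2Space E]
  {f : G → E} {B : Type u} [NormedAddCommGroup B] [NormedSpace ℂ B] [CompleteSpace B]

omit [CompleteSpace V] [Group G] [LieGroup 𝓘(ℂ, V) ω G] in
theorem eventually_extChartAt_localParam (x : G) : ∀ᶠ h in 𝓝 (0 : V),
    extChartAt 𝓘(ℂ, V) x (localParam x h) - extChartAt 𝓘(ℂ, V) x x = h := by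
  have h1 : ContinuousAt (fun h : V => extChartAt 𝓘(ℂ, V) x x + h) 0 := by fun_prop
  have h2 := h1.preimage_mem_nhds (t := (extChartAt 𝓘(ℂ, V) x).target) (by
    rw [add_zero]
    exact extChartAt_target_mem_nhds x)
  filter_upwards [h2] with h hh
  rw [localParam, (extChartAt 𝓘(ℂ, V) x).right_inv hh, add_sub_cancel_left]

omit [CompleteSpace V] [Group G] [LieGroup 𝓘(ℂ, V) ω G] in
theorem localParam_extChartAt {x y : G} (hy : y ∈ (extChartAt 𝓘(ℂ, V) x).source) :
    localParam x (extChartAt 𝓘(ℂ, V) x y - extChartAt 𝓘(ℂ, V) x x) = y := by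
  rw [localParam, add_sub_cancel, (extChartAt 𝓘(ℂ, V) x).left_inv hy]

/-- The left invariant vector fields in the chart at `1`. -/
theorem exists_chart_leftInvDeriv (x : V) :
    ∃ a : V → V, AnalyticAt ℂ a 0 ∧ a 0 = x ∧ ∀ {E : Type u} [AddCommGroup E] [Module ℂ E]
      [TopologicalSpace E] [IsTopologicalAddGroup E] [ContinuousSMul ℂ E]
      [LocallyConvexSpace ℝ E] [T2Space E] {f : G → E} {B : Type u} [NormedAddCommGroup B]
      [NormedSpace ℂ B] [CompleteSpace B], IsHolomorphic V f → ∀ (T : E →L[ℂ] B),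
      ∀ᶠ h in 𝓝 (0 : V), T (leftInvDeriv V (show GroupLieAlgebra 𝓘(ℂ, V) G from x) f (localParam 1 h)) =
        fderiv ℂ (fun y => T (f (localParam 1 y))) h (a h) := by
  set e := extChartAt 𝓘(ℂ, V) (1 : G) with he
  set ψ : ℂ × V → G := fun p => localParam (1 : G) p.2 * localParam (1 : G) (p.1 • x)
    with hψdef
  -- Right multiplication by the curve in direction `x`, in the chart at 1. Its `z`-derivative at 0
  -- is the field `a`, which depends on neither `f` nor `T`.
  set m : ℂ × V → V := fun p => e (ψ p) - e 1 with hmdef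
  have hψ0 : ψ 0 = 1 := by simp [hψdef, localParam_zero]
  have hψ : ContMDiffAt 𝓘(ℂ, ℂ × V) 𝓘(ℂ, V) ω ψ 0 :=
    (eventually_contMDiffAt_localParam_snd (1 : G)).self_of_nhds.mul
      (eventually_contMDiffAt_localParam_fst (G := G) x).self_of_nhds
  have hm : AnalyticAt ℂ m 0 := by
    have h1 := (contMDiffAt_iff_target.1 hψ).2
    rw [hψ0] at h1
    exact (contMDiffAt_iff_contDiffAt.1 h1).analyticAt.sub analyticAt_const
  have hψm : ∀ᶠ p in 𝓝 (0 : ℂ × V), localParam (1 : G) (m p) = ψ p := by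
    have h1 := hψ.continuousAt.preimage_mem_nhds (t := e.source) (by
      rw [hψ0]
      exact extChartAt_source_mem_nhds 1)
    filter_upwards [h1] with p hp using localParam_extChartAt hp
  have hi : Continuous fun h : V => ((0, h) : ℂ × V) := by fun_prop
  have hi0 : Tendsto (fun h : V => ((0, h) : ℂ × V)) (𝓝 0) (𝓝 0) := hi.tendsto 0
  have hj : ∀ h : V, HasDerivAt (fun z : ℂ => ((z, h) : ℂ × V)) (1, 0) 0 := fun h =>
    (hasDerivAt_id (0 : ℂ)).prodMk (hasDerivAt_const 0 h)
  have hm0 : ∀ᶠ h in 𝓝 (0 : V), m (0, h) = h := by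
    filter_upwards [eventually_extChartAt_localParam (1 : G)] with h hh
    simp only [hmdef, hψdef, zero_smul, localParam_zero, mul_one]
    exact hh
  refine ⟨fun h => fderiv ℂ m (0, h) (1, 0), ?_, ?_, ?_⟩
  · have h1 : AnalyticAt ℂ (fun h : V => ((0, h) : ℂ × V)) 0 := by fun_prop
    have h2 : AnalyticAt ℂ (fun h : V => fderiv ℂ m (0, h)) 0 :=
      AnalyticAt.comp (g := fderiv ℂ m) (f := fun h : V => ((0, h) : ℂ × V)) hm.fderiv h1
    exact ((ContinuousLinearMap.apply ℂ V ((1, 0) : ℂ × V)).analyticAt _).comp h2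
  · have h1 : HasDerivAt (fun z : ℂ => m (z, 0)) (fderiv ℂ m (0, 0) (1, 0)) 0 :=
      HasFDerivAt.comp_hasDerivAt (f := fun z : ℂ => ((z, 0) : ℂ × V)) (0 : ℂ)
        hm.differentiableAt.hasFDerivAt (hj 0)
    have h2 : (fun z : ℂ => m (z, 0)) =ᶠ[𝓝 0] fun z => z • x := by
      have h3 : Tendsto (fun z : ℂ => z • x) (𝓝 0) (𝓝 0) := by
        have : Continuous fun z : ℂ => z • x := by fun_prop
        simpa using this.tendsto 0
      filter_upwards [h3.eventually (eventually_extChartAt_localParam (1 : G))] with z hz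
      simp only [hmdef, hψdef, localParam_zero, one_mul]
      exact hz
    have h4 : HasDerivAt (fun z : ℂ => z • x) x 0 := by
      simpa using (hasDerivAt_id (0 : ℂ)).smul_const x
    exact h1.unique (h4.congr_of_eventuallyEq h2)
  · intro E _ _ _ _ _ _ _ f B _ _ _ hf T
    have hF : AnalyticAt ℂ (fun y => T (f (localParam 1 y))) (0 : V) :=
      (hf.taylorAt_comp (contMDiffAt_localParam_zero (1 : G))).1 B T
    filter_upwards [hm0, hi0.eventually hψm.eventually_nhds,
      hi0.eventually hm.eventually_analyticAt, hF.eventually_analyticAt] with h h1 h2 h3 h4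
    have h5 : HasDerivAt (fun z : ℂ => m (z, h)) (fderiv ℂ m (0, h) (1, 0)) 0 :=
      HasFDerivAt.comp_hasDerivAt (f := fun z : ℂ => ((z, h) : ℂ × V)) (0 : ℂ)
        h3.differentiableAt.hasFDerivAt (hj h)
    have h6 : HasFDerivAt (fun y => T (f (localParam 1 y)))
        (fderiv ℂ (fun y => T (f (localParam 1 y))) h) (m (0, h)) := by
      rw [h1]
      exact h4.differentiableAt.hasFDerivAt
    have h7 := HasFDerivAt.comp_hasDerivAt (f := fun z : ℂ => m (z, h)) (0 : ℂ) h6 h5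
    have h8 := hf.hasDerivAt_leftInvDeriv x (localParam 1 h) T
    refine h8.unique (h7.congr_of_eventuallyEq ?_)
    filter_upwards [(hj h).continuousAt.eventually h2] with z hz
    simp only [Function.comp_apply]
    rw [hz]

/-- Strong induction on the order. In the chart the left invariant field of `x` is `a` with `a 0 =
x`, so the constant-direction derivative of `F` equals the left invariant derivative minus `DF · (a
- x)`. The former vanishes to order `n` by induction, as its words are words of `f` with `x`
appended; the latter is a product handled by the Leibniz estimate. -/
theorem iteratedFDeriv_eq_zero_of_leftInvDiffOp (T : E →L[ℂ] B) (n : ℕ) :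
    ∀ f : G → E, IsHolomorphic V f →
      (∀ D : List (GroupLieAlgebra 𝓘(ℂ, V) G), T (leftInvDiffOp V D f 1) = 0) →
      iteratedFDeriv ℂ n (fun y : V => T (f (localParam (1 : G) y))) 0 = 0 := by
  induction n using Nat.strong_induction_on with
  | _ n ih =>
    intro f hf hD
    have hF : AnalyticAt ℂ (fun y => T (f (localParam 1 y))) (0 : V) :=
      (hf.taylorAt_comp (contMDiffAt_localParam_zero (1 : G))).1 B T
    rcases n with _ | n
    · ext v
      simpa [localParam_zero, leftInvDiffOp_nil] using hD []
    · set F : V → B := fun y => T (f (localParam (1 : G) y)) with hFdef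
      have key : ∀ x : V, iteratedFDeriv ℂ n (fun y => fderiv ℂ F y x) 0 = 0 := by
        intro x
        obtain ⟨a, ha, ha0, hx⟩ := exists_chart_leftInvDeriv.{u} (G := G) x
        have hx := hx hf T
        have hL : AnalyticAt ℂ (fun y => T (leftInvDeriv V x f (localParam 1 y))) (0 : V) :=
          ((hf.leftInvDeriv x).taylorAt_comp (contMDiffAt_localParam_zero (1 : G))).1 B T
        have hax : AnalyticAt ℂ (fun y => a y - x) 0 := ha.sub analyticAt_const
        have e1 : (fun y => fderiv ℂ F y x) =ᶠ[𝓝 0]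
            fun y => T (leftInvDeriv V x f (localParam 1 y)) - fderiv ℂ F y (a y - x) := by
          filter_upwards [hx] with y hy
          rw [hy, ← map_sub, sub_sub_cancel]
        have hprod : AnalyticAt ℂ (fun y => fderiv ℂ F y (a y - x)) 0 :=
          ((hF.fderiv.contDiffAt (n := ω)).clm_apply hax.contDiffAt).analyticAt
        have e2 : iteratedFDeriv ℂ n (fun y => fderiv ℂ F y (a y - x)) 0 = 0 := by
          obtain ⟨s, hs, hso, h0⟩ := eventually_nhds_iff.1
            (hF.fderiv.eventually_analyticAt.and hax.eventually_analyticAt)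
          have hu : UniqueDiffOn ℂ s := hso.uniqueDiffOn
          have hb := ContinuousLinearMap.norm_iteratedFDerivWithin_le_of_bilinear
            (ContinuousLinearMap.id ℂ (V →L[ℂ] B)) (N := ω) (f := fderiv ℂ F)
            (g := fun y => a y - x) (s := s) (x := 0) (n := n)
            (fun y hy => ((hs y hy).1.contDiffAt).contDiffWithinAt)
            (fun y hy => ((hs y hy).2.contDiffAt).contDiffWithinAt) hu h0 le_top
          rw [iteratedFDerivWithin_of_isOpen n hso h0] at hb
          rw [← norm_le_zero_iff]
          refine hb.trans (le_of_eq ?_)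
          rw [Finset.sum_eq_zero, mul_zero]
          intro i hi
          rw [iteratedFDerivWithin_of_isOpen _ hso h0, iteratedFDerivWithin_of_isOpen _ hso h0,
            norm_iteratedFDeriv_fderiv]
          -- For `i < n` the factor is a derivative of `F` of order `i + 1 ≤ n`, zero by induction.
          -- For `i = n` the other factor is `a 0 - x = 0`.
          rcases (Nat.lt_succ_iff.1 (Finset.mem_range.1 hi)).lt_or_eq with hlt | rfl
          · rw [ih (i + 1) (by omega) f hf hD]
            simp
          · rw [Nat.sub_self, norm_iteratedFDeriv_zero, ha0, sub_self, norm_zero, mul_zero]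
        rw [(e1.iteratedFDeriv ℂ n).eq_of_nhds]
        have e3 := iteratedFDeriv_sub_apply (i := n) (hL.contDiffAt (n := n)) (hprod.contDiffAt (n := n))
        have e4 := ih n (by omega) (leftInvDeriv V x f) (hf.leftInvDeriv x) fun D => by
          have := hD (D ++ [(show GroupLieAlgebra 𝓘(ℂ, V) G from x)])
          rw [leftInvDiffOp_concat] at this
          exact this
        rw [e2, e4, sub_zero] at e3
        exact e3
      ext v
      rw [iteratedFDeriv_succ_apply_right]
      have e5 := (ContinuousLinearMap.apply ℂ B (v (Fin.last n))).iteratedFDeriv_comp_left (n := ω)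
        hF.fderiv.contDiffAt (i := n) le_top
      have e6 : (fun y => fderiv ℂ F y (v (Fin.last n))) =
        (ContinuousLinearMap.apply ℂ B (v (Fin.last n))) ∘ fun y => fderiv ℂ F y := rfl
      have e7 := key (v (Fin.last n))
      rw [e6, e5] at e7
      exact DFunLike.congr_fun e7 (Fin.init v)

theorem eventually_eq_zero_of_leftInvDiffOp (hf : IsHolomorphic V f) (T : E →L[ℂ] B) {g : G}
    (hD : ∀ D : List (GroupLieAlgebra 𝓘(ℂ, V) G), T (leftInvDiffOp V D f g) = 0) :
    ∀ᶠ h in 𝓝 g, T (f h) = 0 := by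
  have h1 : ∀ᶠ h in 𝓝 (1 : G), T (f (g * h)) = 0 := by
    have hf' := hf.mul_left g
    have hF : AnalyticAt ℂ (fun y => T (f (g * localParam 1 y))) (0 : V) :=
      (hf'.taylorAt_comp (contMDiffAt_localParam_zero (1 : G))).1 B T
    obtain ⟨p, r, hp⟩ := hF
    have h2 : ∀ᶠ y in 𝓝 (0 : V), T (f (g * localParam 1 y)) = 0 := by
      filter_upwards [Metric.eball_mem_nhds (0 : V) hp.r_pos] with y hy
      have h3 := hp.hasSum_iteratedFDeriv hy
      simp only [zero_add] at h3
      refine h3.unique ?_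
      have h4 := fun n => iteratedFDeriv_eq_zero_of_leftInvDiffOp T n _ hf' fun D => by
        rw [leftInvDiffOp_comp_mul_left]
        simpa using hD D
      simp [h4, hasSum_zero]
    have h5 : Tendsto (fun h : G => extChartAt 𝓘(ℂ, V) (1 : G) h - extChartAt 𝓘(ℂ, V) (1 : G) 1)
        (𝓝 1) (𝓝 0) := by
      have := (continuousAt_extChartAt (I := 𝓘(ℂ, V)) (1 : G)).tendsto.sub_const
        (extChartAt 𝓘(ℂ, V) (1 : G) 1)
      rwa [sub_self] at this
    filter_upwards [h5.eventually h2, extChartAt_source_mem_nhds (I := 𝓘(ℂ, V)) (1 : G)]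
      with h h6 h7
    rwa [localParam_extChartAt h7] at h6
  have := topologicalGroup_of_lieGroup 𝓘(ℂ, V) ω (G := G)
  have h2 : Tendsto (fun h : G => g⁻¹ * h) (𝓝 g) (𝓝 1) := by
    have : Continuous fun h : G => g⁻¹ * h := by fun_prop
    simpa using this.tendsto g
  filter_upwards [h2.eventually h1] with h hh
  simpa using hh

theorem eventually_clm_leftInvDiffOp_eq_zero (hf : IsHolomorphic V f) (T : E →L[ℂ] B) {g : G}
    (h : ∀ᶠ h in 𝓝 g, T (f h) = 0) (D : List (GroupLieAlgebra 𝓘(ℂ, V) G)) :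
    ∀ᶠ h in 𝓝 g, T (leftInvDiffOp V D f h) = 0 := by
  induction D with
  | nil => exact h
  | cons x D ih =>
    filter_upwards [ih.eventually_nhds] with h hh
    rw [leftInvDiffOp_cons, clm_leftInvDeriv (hf.leftInvDiffOp D)]
    have h1 : (fun h => T (leftInvDiffOp V D f h)) =ᶠ[𝓝 h] fun _ => 0 := hh
    rw [h1.mfderiv_eq, mfderiv_const]
    rfl

/-- The identity theorem: a holomorphic map on a connected group is determined by its left
invariant derivatives at `1`. -/
theorem eq_zero_of_leftInvDiffOp [ConnectedSpace G] (hf : IsHolomorphic V f)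
    (hD : ∀ D : List (GroupLieAlgebra 𝓘(ℂ, V) G), leftInvDiffOp V D f 1 = 0) : f = 0 := by
  funext g
  refine eq_of_forall_clm fun B _ _ _ T => ?_
  -- For fixed `T` the set where all derivatives vanish is closed by continuity, and open because
  -- the power series at such a point is zero.
  set A : Set G := {g | ∀ D : List (GroupLieAlgebra 𝓘(ℂ, V) G), T (leftInvDiffOp V D f g) = 0}
    with hA
  have hclosed : IsClosed A := by
    rw [hA, Set.ofPred_forall]
    exact isClosed_iInter fun D =>
      isClosed_eq (T.continuous.comp (hf.leftInvDiffOp D).1) continuous_const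
  have hopen : IsOpen A := by
    rw [isOpen_iff_mem_nhds]
    intro g hg
    have h1 := (eventually_eq_zero_of_leftInvDiffOp hf T hg).eventually_nhds
    filter_upwards [h1] with h hh D
    exact (eventually_clm_leftInvDiffOp_eq_zero hf T hh D).self_of_nhds
  have huniv : A = Set.univ := IsClopen.eq_univ ⟨hclosed, hopen⟩ ⟨1, fun D => by rw [hD, map_zero]⟩
  have hg : g ∈ A := huniv ▸ Set.mem_univ g
  simpa [leftInvDiffOp_nil] using hg []

end Identity

/-! ### The underlying real Lie group -/

section Restrict

variable {V : Type*} [NormedAddCommGroup V] [NormedSpace ℂ V]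
  {G : Type*} [TopologicalSpace G] [ChartedSpace V G]

/-- One-parameter groups are obtained from integral curves over `ℝ`, so the complex structure is
restricted, with the same charts. -/
theorem ChartedSpace.isManifold_real [IsManifold 𝓘(ℂ, V) ω G] : IsManifold 𝓘(ℝ, V) ω G := by
  refine isManifold_of_contDiffOn _ _ _ fun e e' he he' => ?_
  exact ((contDiffGroupoid ω 𝓘(ℂ, V)).compatible he he').1.restrict_scalars ℝ

variable [Group G] [LieGroup 𝓘(ℂ, V) ω G]

theorem lieGroup_real : LieGroup 𝓘(ℝ, V) ω G := by
  have : IsManifold 𝓘(ℝ, V) ω G := ChartedSpace.isManifold_real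
  refine { contMDiff_mul := ?_, contMDiff_inv := ?_ }
  · intro p
    have h := contMDiffAt_iff.1 ((contMDiff_mul 𝓘(ℂ, V) ω (G := G)) p)
    exact contMDiffAt_iff.2 ⟨h.1, h.2.restrict_scalars ℝ⟩
  · intro p
    have h := contMDiffAt_iff.1 ((contMDiff_inv 𝓘(ℂ, V) ω (G := G)) p)
    exact contMDiffAt_iff.2 ⟨h.1, h.2.restrict_scalars ℝ⟩

theorem lieGroup_t2Space (V : Type*) [NormedAddCommGroup V] [NormedSpace ℂ V]
    {G : Type*} [TopologicalSpace G] [ChartedSpace V G] [Group G] [LieGroup 𝓘(ℂ, V) ω G] :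
    T2Space G := by
  have := 𝓘(ℂ, V).t1Space G
  have := topologicalGroup_of_lieGroup 𝓘(ℂ, V) ω (G := G)
  infer_instance

end Restrict

/-! ### Existence of one-parameter groups -/

section Integral

variable {V : Type*} [NormedAddCommGroup V] [NormedSpace ℝ V] 
  {G : Type*} [TopologicalSpace G] [ChartedSpace V G] [Group G] [LieGroup 𝓘(ℝ, V) ω G]

theorem mulInvariantVectorField_mul (x : GroupLieAlgebra 𝓘(ℝ, V) G) (g h : G) :
    mulInvariantVectorField x (g * h) =
      mfderiv 𝓘(ℝ, V) 𝓘(ℝ, V) (fun k => g * k) h (mulInvariantVectorField x h) := by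
  have h1 : (fun k => g * h * k) = (fun k => g * k) ∘ fun k => h * k := by
    ext k
    exact mul_assoc g h k
  have hd : ∀ g h : G, MDifferentiableAt 𝓘(ℝ, V) 𝓘(ℝ, V) (fun k => g * k) h := fun g h =>
    (contMDiff_mul_left (I := 𝓘(ℝ, V)) (n := ω) (a := g)).mdifferentiable (by simp) h
  rw [mulInvariantVectorField, h1,
    mfderiv_comp (I' := 𝓘(ℝ, V)) _ (hd g (h * 1)) (hd h 1)]
  exact congrArg (fun k : G => (mfderiv 𝓘(ℝ, V) 𝓘(ℝ, V) (fun k => g * k) k : V →L[ℝ] V)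
    (mulInvariantVectorField x h)) (mul_one h)

theorem isMIntegralCurveOn_mul_left {x : GroupLieAlgebra 𝓘(ℝ, V) G} {γ : ℝ → G} {s : Set ℝ}
    (hγ : IsMIntegralCurveOn γ (mulInvariantVectorField x) s) (g : G) :
    IsMIntegralCurveOn (fun t => g * γ t) (mulInvariantVectorField x) s := by
  intro t ht
  have hd : HasMFDerivAt 𝓘(ℝ, V) 𝓘(ℝ, V) (fun k => g * k) (γ t) _ :=
    ((contMDiff_mul_left (I := 𝓘(ℝ, V)) (n := ω) (a := g)).mdifferentiable (by simp)
      (γ t)).hasMFDerivAt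
  have h1 := hd.comp_hasMFDerivWithinAt t (hγ t ht)
  refine h1.congr_mfderiv ?_
  refine ContinuousLinearMap.ext_ring ?_
  refine (congrArg (mfderiv 𝓘(ℝ, V) 𝓘(ℝ, V) (fun k => g * k) (γ t)) (one_smul ℝ _)).trans ?_
  rw [← mulInvariantVectorField_mul]
  exact (one_smul ℝ _).symm

/-- Left translates of a local integral curve through 1 are integral curves through every point with
the same existence time, so a global integral curve exists. `t ↦ γ(s + t)` and `t ↦ γ(s)γ(t)` are
integral curves through the same point, whence the homomorphism law. -/
theorem exists_isOneParameterGroup_real [CompleteSpace V] [T2Space G]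
    (x : GroupLieAlgebra 𝓘(ℝ, V) G) : ∃ γ : ℝ → G, Continuous γ ∧ γ 0 = 1 ∧
      (∀ s t, γ (s + t) = γ s * γ t) ∧
      HasDerivAt (fun t => extChartAt 𝓘(ℝ, V) (1 : G) (γ t)) (show V from x) 0 := by
  have : IsManifold 𝓘(ℝ, V) 1 G := IsManifold.of_le (n := ω) le_top
  have : LieGroup 𝓘(ℝ, V) (minSmoothness ℝ 3) G := LieGroup.of_le (n := ω) le_top
  have hv := (contMDiff_mulInvariantVectorField x).of_le (m := 1) (by simp)
  obtain ⟨γ₀, h0, hγ₀⟩ := exists_isMIntegralCurveAt_of_contMDiffAt_boundaryless (t₀ := 0)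
    (x₀ := (1 : G)) hv.contMDiffAt
  obtain ⟨ε, hε, hγ₀⟩ := isMIntegralCurveAt_iff'.1 hγ₀
  obtain ⟨γ, hγ0, hγ⟩ := exists_isMIntegralCurve_of_isMIntegralCurveOn hv hε (fun g =>
    ⟨fun t => g * γ₀ t, by simp [h0], by
      have := isMIntegralCurveOn_mul_left hγ₀ g
      rwa [Real.ball_eq_Ioo, zero_sub, zero_add] at this⟩) (1 : G)
  refine ⟨γ, hγ.continuous, hγ0, fun s t => ?_, ?_⟩
  · have h1 : IsMIntegralCurve (fun t => γ s * γ t) (mulInvariantVectorField x) :=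
      isMIntegralCurve_iff_isMIntegralCurveOn.2
        (isMIntegralCurveOn_mul_left (hγ.isMIntegralCurveOn _) _)
    have h2 := isMIntegralCurve_Ioo_eq_of_contMDiff_boundaryless (t₀ := 0) hv (hγ.comp_add s) h1
      (by simp [hγ0])
    simpa [add_comm] using congrFun h2 t
  · have h1 := (hγ.isMIntegralCurveAt 0).eventually_hasDerivAt.self_of_nhds
    rw [hγ0] at h1
    refine h1.congr_deriv ?_
    have h2 : mulInvariantVectorField x (1 : G) = x := by
      have h3 : (fun k : G => 1 * k) = id := by simp [funext_iff]
      rw [mulInvariantVectorField, h3, mfderiv_id]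
      rfl
    exact (tangentCoordChange_self (mem_extChartAt_source _)).trans h2

end Integral

/-! ### One-parameter groups of a complex Lie group -/

section Exp
variable {V : Type*} [NormedAddCommGroup V] [NormedSpace ℂ V] [CompleteSpace V]
  {G : Type*} [TopologicalSpace G] [ChartedSpace V G] [Group G] [LieGroup 𝓘(ℂ, V) ω G]

theorem exists_isOneParameterGroup (x : GroupLieAlgebra 𝓘(ℂ, V) G) :
    ∃ γ : ℝ → G, IsOneParameterGroup V x γ := by
  have := lieGroup_real (V := V) (G := G)
  have := lieGroup_t2Space V (G := G)
  obtain ⟨γ, h1, h2, h3, h4⟩ := exists_isOneParameterGroup_real (V := V) (G := G) x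
  exact ⟨γ, h1, h2, h3, h4⟩

end Exp

/-! ### Derivatives along one-parameter groups -/

section Velocity

variable {V : Type*} [NormedAddCommGroup V] [NormedSpace ℂ V]
  {G : Type*} [TopologicalSpace G] [ChartedSpace V G] [Group G]
  {x : GroupLieAlgebra 𝓘(ℂ, V) G} {γ : ℝ → G}

theorem IsOneParameterGroup.inv_eq (hγ : IsOneParameterGroup V x γ) (t : ℝ) :
    (γ t)⁻¹ = γ (-t) := by
  rw [inv_eq_iff_mul_eq_one, ← hγ.map_add, add_neg_cancel, hγ.map_zero]

variable [CompleteSpace V] [LieGroup 𝓘(ℂ, V) ω G]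
  {E : Type u} [AddCommGroup E] [Module ℂ E] [TopologicalSpace E]
  [IsTopologicalAddGroup E] [ContinuousSMul ℂ E] [LocallyConvexSpace ℝ E] [T2Space E]
  {f : G → E}

theorem IsHolomorphic.hasDerivAt_oneParameterGroup (hf : IsHolomorphic V f)
    (hγ : IsOneParameterGroup V x γ) {B : Type u} [NormedAddCommGroup B] [NormedSpace ℂ B]
    [CompleteSpace B] (T : E →L[ℂ] B) :
    HasDerivAt (fun t => T (f (γ t))) (T (tangent V f 1 x)) 0 := by
  have h0 := hγ.map_zero
  have h1 := hasDerivAt_comp_curve (F := fun g => T (f g)) (γ := γ) (t := 0)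
    ((hf.contMDiff T).mdifferentiable (by simp) _) hγ.continuous.continuousAt
    (by rw [h0]; exact hγ.hasDerivAt)
  rw [h0] at h1
  exact h1.congr_deriv (clm_tangent hf 1 x T).symm

theorem IsHolomorphic.hasVelocity_mul_left (hf : IsHolomorphic V f)
    (hγ : IsOneParameterGroup V x γ) (g : G) :
    HasVelocity (fun t => f (g * γ t)) (HolInd.leftInvDeriv V x f g) :=
  hasVelocity_of_forall_clm fun _ _ _ _ T => (hf.mul_left g).hasDerivAt_oneParameterGroup hγ T

theorem IsHolomorphic.hasVelocity_mul_left_inv (hf : IsHolomorphic V f)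
    (hγ : IsOneParameterGroup V x γ) (g : G) :
    HasVelocity (fun t => f (g * (γ t)⁻¹)) (-HolInd.leftInvDeriv V x f g) := by
  refine hasVelocity_of_forall_clm fun B _ _ _ T => ?_
  have h1 := (hf.mul_left g).hasDerivAt_oneParameterGroup hγ T
  rw [← neg_zero] at h1
  have h2 := h1.scomp (0 : ℝ) (hasDerivAt_neg (0 : ℝ))
  rw [neg_one_smul, ← map_neg] at h2
  simp only [hγ.inv_eq]
  exact h2

end Velocity

/-! ### The subgroup `P` and the equivariant sections -/

section Subgroup

variable {V : Type*} [NormedAddCommGroup V] [NormedSpace ℂ V] [CompleteSpace V]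
  {G : Type*} [TopologicalSpace G] [ChartedSpace V G] [Group G] [LieGroup 𝓘(ℂ, V) ω G]
  {W : Type*} [NormedAddCommGroup W] [NormedSpace ℂ W] [CompleteSpace W]
  {P : Subgroup G} [ChartedSpace W P] [LieGroup 𝓘(ℂ, W) ω P]
  {E : Type u} [AddCommGroup E] [Module ℂ E] [TopologicalSpace E]
  [IsTopologicalAddGroup E] [ContinuousSMul ℂ E] [LocallyConvexSpace ℝ E] [T2Space E]
  {f : G → E}

theorem leftInvDeriv_comp_val (hP : ContMDiff 𝓘(ℂ, W) 𝓘(ℂ, V) ω (Subtype.val : P → G))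
    (hf : IsHolomorphic V f) (y : GroupLieAlgebra 𝓘(ℂ, W) P) :
    leftInvDeriv W y (fun p : P => f p) = fun p : P => leftInvDeriv V (lieIncl V W P y) f p := by
  funext p
  refine eq_of_forall_clm fun B _ _ _ T => ?_
  have h1 := clm_tangent ((hf.comp_contMDiff hP).mul_left p) 1 y T
  have h2 := clm_tangent (hf.mul_left (p : G)) 1 (lieIncl V W P y) T
  refine h1.trans (Eq.trans ?_ h2.symm)
  have h3 := mfderiv_comp (I' := 𝓘(ℂ, V)) (I'' := 𝓘(ℂ, B)) (g := fun h => T (f (p * h)))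
    (f := (Subtype.val : P → G)) (1 : P)
    (((hf.mul_left (p : G)).contMDiff T).mdifferentiable (by simp) _)
    (hP.mdifferentiable (by simp) _)
  exact DFunLike.congr_fun h3 y

theorem leftInvDiffOp_comp_val (hP : ContMDiff 𝓘(ℂ, W) 𝓘(ℂ, V) ω (Subtype.val : P → G))
    (hf : IsHolomorphic V f) (D : List (GroupLieAlgebra 𝓘(ℂ, W) P)) :
    leftInvDiffOp W D (fun p : P => f p) =
      fun p : P => leftInvDiffOp V (D.map (lieIncl V W P)) f p := by
  induction D with
  | nil => rfl
  | cons y D ih =>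
    rw [leftInvDiffOp_cons, ih, leftInvDeriv_comp_val hP (hf.leftInvDiffOp _)]
    rfl

-- Inversion reverses time along a one-parameter group, hence the sign.
omit [CompleteSpace V] [LieGroup 𝓘(ℂ, V) ω G] in
theorem HolRep.leftInvDeriv_inv (ρ : HolRep W E P) (y : GroupLieAlgebra 𝓘(ℂ, W) P) (e : E) :
    leftInvDeriv W y (fun p : P => ρ.toHom p⁻¹ e) 1 = -ρ.derived y e := by
  obtain ⟨δ, hδ⟩ := exists_isOneParameterGroup y
  have h1 := ((ρ.holomorphic e).comp_inv).hasVelocity_mul_left hδ 1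
  have h2 := (ρ.holomorphic e).hasVelocity_mul_left_inv hδ 1
  simp only [one_mul] at h1 h2
  have h3 := h1.velocity_eq.symm.trans h2.velocity_eq
  rw [h3, HolInd.leftInvDeriv]
  simp only [one_mul]
  rfl

/-- Differentiate `f (g p) = ρ(p)⁻¹ f(g)` in `p` at 1. -/
theorem HolSections.leftInvDeriv_lieIncl
    (hP : ContMDiff 𝓘(ℂ, W) 𝓘(ℂ, V) ω (Subtype.val : P → G)) {ρ : HolRep W E P}
    (hf : f ∈ HolSections V ρ) (y : GroupLieAlgebra 𝓘(ℂ, W) P) (g : G) :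
    leftInvDeriv V (lieIncl V W P y) f g = -ρ.derived y (f g) := by
  have h1 := congrFun (leftInvDeriv_comp_val hP (hf.1.mul_left g) y) 1
  have h2 : (fun p : P => f (g * p)) = fun p : P => ρ.toHom p⁻¹ (f g) := funext fun p => hf.2 g p
  rw [h2, ρ.leftInvDeriv_inv, leftInvDeriv_comp_mul_left] at h1
  simpa using h1.symm

-- Right invariant fields differentiate left translations, which commute with right translation by
-- `P`; the continuous operator `ρ(p)⁻¹` passes through the limit.
omit [CompleteSpace W] [LieGroup 𝓘(ℂ, W) ω P] in
theorem HolSections.rightInvDeriv_mem {ρ : HolRep W E P}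
    (hf : f ∈ HolSections V ρ) (x : GroupLieAlgebra 𝓘(ℂ, V) G) :
    rightInvDeriv V x f ∈ HolSections V ρ := by
  refine ⟨hf.1.rightInvDeriv x, fun g p => ?_⟩
  have h1 := ((hf.1.mul_right g).hasVelocity_tangent 1 x).clm_comp (ρ.toHom p⁻¹)
  have h2 : (fun h => f (h * (g * p))) = fun h => ρ.toHom p⁻¹ (f (h * g)) :=
    funext fun h => by rw [← mul_assoc, hf.2]
  rw [rightInvDeriv, h2]
  exact h1.velocity_eq

omit [CompleteSpace W] [LieGroup 𝓘(ℂ, W) ω P] in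
theorem HolSections.rightInvDiffOp_mem {ρ : HolRep W E P}
    (hf : f ∈ HolSections V ρ) (D : List (GroupLieAlgebra 𝓘(ℂ, V) G)) :
    rightInvDiffOp V D f ∈ HolSections V ρ := by
  induction D generalizing f with
  | nil => exact hf
  | cons x D ih => exact ih (rightInvDeriv_mem hf x)

end Subgroup

/-! ### Monomials span the enveloping algebra -/

section Enveloping

attribute [local instance 100] LieRing.ofAssociativeRing

variable {V : Type*} [NormedAddCommGroup V] [NormedSpace ℂ V] [CompleteSpace V]
  {G : Type*} [TopologicalSpace G] [ChartedSpace V G] [Group G] [LieGroup 𝓘(ℂ, V) ω G]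

/-- Lift the canonical map, corestricted to the subalgebra `S` it generates. Composed with the
inclusion, the lift is the identity by uniqueness, so `S` is everything. -/
theorem adjoin_range_env : Algebra.adjoin ℂ (Set.range (env V G)) = ⊤ := by
  set S := Algebra.adjoin ℂ (Set.range (env V G)) with hS
  let j : GroupLieAlgebra 𝓘(ℂ, V) G →ₗ⁅ℂ⁆ S :=
    { toFun := fun x => ⟨env V G x, Algebra.subset_adjoin ⟨x, rfl⟩⟩
      map_add' := fun x y => Subtype.ext (map_add (env V G) x y)
      map_smul' := fun c x => Subtype.ext (map_smul (env V G) c x)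
      map_lie' := fun {x y} => Subtype.ext (LieHom.map_lie (UniversalEnvelopingAlgebra.ι ℂ) x y) }
  have h : (Subalgebra.val S).comp (UniversalEnvelopingAlgebra.lift ℂ j) = AlgHom.id ℂ (Env V G) := by
    refine UniversalEnvelopingAlgebra.hom_ext (R := ℂ) (L := GroupLieAlgebra 𝓘(ℂ, V) G) ?_
    ext x
    simp [j]
  rw [eq_top_iff]
  intro D _
  have h1 := DFunLike.congr_fun h D
  rw [AlgHom.id_apply] at h1
  rw [← h1]
  exact (UniversalEnvelopingAlgebra.lift ℂ j D).2

/-- Linear maps on `U(𝔤)` are determined by their values on the monomials. -/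
theorem env_linearMap_ext {M : Type*} [AddCommGroup M] [Module ℂ M] {β β' : Env V G →ₗ[ℂ] M}
    (h : ∀ D : List (GroupLieAlgebra 𝓘(ℂ, V) G),
      β (D.map (env V G)).prod = β' (D.map (env V G)).prod) : β = β' := by
  have h1 : Submodule.span ℂ (Submonoid.closure (Set.range (env V G)) : Set (Env V G)) = ⊤ := by
    rw [← Algebra.adjoin_eq_span, adjoin_range_env, Algebra.top_toSubmodule]
  refine LinearMap.ext_on h1 fun D hD => ?_
  obtain ⟨l, hl, rfl⟩ := Submonoid.exists_list_of_mem_closure hD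
  obtain ⟨l', rfl⟩ : ∃ l' : List (GroupLieAlgebra 𝓘(ℂ, V) G), l'.map (env V G) = l := by
    have : l ∈ Set.range (List.map (env V G)) := by
      rw [Set.range_list_map]
      exact hl
    exact this
  exact h l'

end Enveloping

/-! ### The action of `U(𝔤)` on holomorphic maps -/

section Action

attribute [local instance 100] LieRing.ofAssociativeRing

variable (V : Type*) [NormedAddCommGroup V] [NormedSpace ℂ V]
  (G : Type*) [TopologicalSpace G] [ChartedSpace V G]
  (E : Type u) [AddCommGroup E] [Module ℂ E] [TopologicalSpace E]
  [IsTopologicalAddGroup E] [ContinuousSMul ℂ E]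

/-- The space of all holomorphic maps `G → E`. -/
def holFun : Submodule ℂ (G → E) where
  carrier := {f | IsHolomorphic V f}
  add_mem' hf hg := hf.add hg
  zero_mem' := IsHolomorphic.zero
  smul_mem' c _ hf := hf.const_smul c

variable [LocallyConvexSpace ℝ E] [T2Space E] [CompleteSpace V] [Group G] [LieGroup 𝓘(ℂ, V) ω G]

/-- The action of `𝔤` on holomorphic functions by left invariant vector fields. -/
def leftInvLieHom : GroupLieAlgebra 𝓘(ℂ, V) G →ₗ⁅ℂ⁆ Module.End ℂ (holFun V G E) where
  toFun x :=
    { toFun := fun f => ⟨leftInvDeriv V x f.1, IsHolomorphic.leftInvDeriv f.2 x⟩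
      map_add' := fun f f' => Subtype.ext <| funext fun g =>
        tangent_add (IsHolomorphic.mul_left f.2 g) (IsHolomorphic.mul_left f'.2 g) 1 x
      map_smul' := fun c f => Subtype.ext <| funext fun g =>
        tangent_const_smul (IsHolomorphic.mul_left f.2 g) c 1 x }
  map_add' x y := LinearMap.ext fun f => Subtype.ext <| funext fun g =>
    leftInvDeriv_add_vec f.2 x y g
  map_smul' c x := LinearMap.ext fun f => Subtype.ext <| funext fun g =>
    leftInvDeriv_smul_vec f.2 c x g
  map_lie' {x y} := LinearMap.ext fun f => Subtype.ext <| funext fun g =>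
    leftInvDeriv_lie f.2 x y g

/-- The action of `U(𝔤)` on holomorphic functions by left invariant differential operators. -/
def leftInvAction : Env V G →ₐ[ℂ] Module.End ℂ (holFun V G E) :=
  UniversalEnvelopingAlgebra.lift ℂ (leftInvLieHom V G E)

variable {V G E}

theorem leftInvAction_env (x : GroupLieAlgebra 𝓘(ℂ, V) G) (f : holFun V G E) :
    (leftInvAction V G E (env V G x) f).1 = leftInvDeriv V x f.1 := by
  have : leftInvAction V G E (env V G x) = leftInvLieHom V G E x :=
    UniversalEnvelopingAlgebra.lift_ι_apply ℂ _ x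
  rw [this]
  rfl

theorem leftInvAction_prod (D : List (GroupLieAlgebra 𝓘(ℂ, V) G)) (f : holFun V G E) :
    (leftInvAction V G E (D.map (env V G)).prod f).1 = leftInvDiffOp V D f.1 := by
  induction D with
  | nil => simp [leftInvDiffOp_nil]
  | cons x D ih =>
    rw [List.map_cons, List.prod_cons, map_mul, Module.End.mul_apply, leftInvAction_env, ih,
      leftInvDiffOp_cons]

end Action

/-! ### The Taylor map -/

section Taylor

variable {V : Type*} [NormedAddCommGroup V] [NormedSpace ℂ V] [CompleteSpace V]
  {G : Type*} [TopologicalSpace G] [ChartedSpace V G] [Group G] [LieGroup 𝓘(ℂ, V) ω G]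
  {W : Type*} [NormedAddCommGroup W] [NormedSpace ℂ W] [CompleteSpace W]
  {P : Subgroup G} [ChartedSpace W P] [LieGroup 𝓘(ℂ, W) ω P]
  {E : Type u} [AddCommGroup E] [Module ℂ E] [TopologicalSpace E]
  [IsTopologicalAddGroup E] [ContinuousSMul ℂ E] [LocallyConvexSpace ℝ E] [T2Space E]
  {f : G → E}

/-- The linear form `D ↦ (D_l f)(1)` on `U(𝔤)`. -/
def taylorForm : holFun V G E →ₗ[ℂ] Env V G →ₗ[ℂ] E :=
  LinearMap.mk₂ ℂ (fun f D => (leftInvAction V G E D f).1 1)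
    (fun f f' D => by simp) (fun c f D => by simp) (fun f D D' => by simp)
    (fun c f D => by simp)

theorem taylorForm_apply (f : holFun V G E) (D : Env V G) :
    taylorForm f D = (leftInvAction V G E D f).1 1 := rfl

theorem taylorForm_prod (f : holFun V G E) (D : List (GroupLieAlgebra 𝓘(ℂ, V) G)) :
    taylorForm f (D.map (env V G)).prod = leftInvDiffOp V D f.1 1 := by
  rw [taylorForm_apply, leftInvAction_prod]

/-- In terms of right operators, the last letter of `D x` acts outermost, on the section `D_r f`. At
1 it may be replaced by the left derivative, which acts on sections as `-dρ(x)`. -/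
theorem taylorForm_mem_coind (hP : ContMDiff 𝓘(ℂ, W) 𝓘(ℂ, V) ω (Subtype.val : P → G))
    {ρ : HolRep W E P} (hf : f ∈ HolSections V ρ) : taylorForm ⟨f, hf.1⟩ ∈ Coind V ρ := by
  intro y D
  have key : (taylorForm ⟨f, hf.1⟩).comp (LinearMap.mulRight ℂ (env V G (lieIncl V W P y))) =
      -(ρ.derived y).comp (taylorForm ⟨f, hf.1⟩) := by
    refine env_linearMap_ext fun D => ?_
    have h1 : (D.map (env V G)).prod * env V G (lieIncl V W P y) =
        ((D ++ [lieIncl V W P y]).map (env V G)).prod := by simp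
    simp only [LinearMap.comp_apply, LinearMap.mulRight_apply, LinearMap.neg_apply]
    rw [h1, taylorForm_prod, taylorForm_prod, ← rightInvDiffOp_one hf.1, ← rightInvDiffOp_one hf.1,
      rightInvDiffOp_concat, ← leftInvDeriv_one]
    exact HolSections.leftInvDeriv_lieIncl hP (HolSections.rightInvDiffOp_mem hf D) y 1
  exact DFunLike.congr_fun key D

/-- The Taylor map. -/
def taylorMap (hP : ContMDiff 𝓘(ℂ, W) 𝓘(ℂ, V) ω (Subtype.val : P → G)) (ρ : HolRep W E P) :
    HolSections V ρ →ₗ[ℂ] Coind V ρ :=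
  (taylorForm.comp (Submodule.inclusion (show HolSections V ρ ≤ holFun V G E from
    fun _ hf => hf.1))).codRestrict _ fun f => taylorForm_mem_coind hP f.2

theorem taylorMap_apply (hP : ContMDiff 𝓘(ℂ, W) 𝓘(ℂ, V) ω (Subtype.val : P → G))
    {ρ : HolRep W E P} (f : HolSections V ρ) : (taylorMap hP ρ f).1 = taylorForm ⟨f.1, f.2.1⟩ :=
  rfl

theorem isTaylorMap_taylorMap (hP : ContMDiff 𝓘(ℂ, W) 𝓘(ℂ, V) ω (Subtype.val : P → G))
    (ρ : HolRep W E P) : IsTaylorMap ρ (taylorMap hP ρ) := fun f D => by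
  rw [taylorMap_apply, taylorForm_prod, rightInvDiffOp_one f.2.1]

/-- The leftmost letter acts outermost; at 1 it becomes a right derivative and then commutes inward
to `f`. It follows that the range is stable under `𝔤`. -/
theorem lie_taylorMap (hP : ContMDiff 𝓘(ℂ, W) 𝓘(ℂ, V) ω (Subtype.val : P → G))
    {ρ : HolRep W E P} (x : GroupLieAlgebra 𝓘(ℂ, V) G) (f : HolSections V ρ) :
    ⁅x, taylorMap hP ρ f⁆ =
      taylorMap hP ρ (-⟨rightInvDeriv V x f.1, HolSections.rightInvDeriv_mem f.2 x⟩) := by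
  rw [map_neg]
  refine Subtype.ext (env_linearMap_ext fun D => ?_)
  rw [coind_lie_apply]
  have h1 : env V G x * (D.map (env V G)).prod = ((x :: D).map (env V G)).prod := by simp
  rw [h1]
  simp only [Submodule.coe_neg, LinearMap.neg_apply, taylorMap_apply, taylorForm_prod]
  rw [leftInvDiffOp_cons, leftInvDeriv_one, leftInvDiffOp_rightInvDeriv f.2.1]

/-- The image of the Taylor map. -/
def taylorRange (hP : ContMDiff 𝓘(ℂ, W) 𝓘(ℂ, V) ω (Subtype.val : P → G)) (ρ : HolRep W E P) :
    LieSubmodule ℂ (GroupLieAlgebra 𝓘(ℂ, V) G) (Coind V ρ) :=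
  { LinearMap.range (taylorMap hP ρ) with
    lie_mem := by
      rintro x _ ⟨f, rfl⟩
      exact ⟨_, (lie_taylorMap hP x f).symm⟩ }

theorem taylorMap_injective [ConnectedSpace G]
    (hP : ContMDiff 𝓘(ℂ, W) 𝓘(ℂ, V) ω (Subtype.val : P → G)) (ρ : HolRep W E P) :
    Function.Injective (taylorMap hP ρ) := by
  rw [injective_iff_map_eq_zero]
  intro f hf
  refine Subtype.ext (eq_zero_of_leftInvDiffOp f.2.1 fun D => ?_)
  rw [← taylorForm_prod ⟨f.1, f.2.1⟩, ← taylorMap_apply hP, hf]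
  rfl

end Taylor

/-! ### The image of the Taylor map integrates -/

section Integration

/-- A representation transported by a linear isomorphism. -/
def conjRep {G M N : Type*} [Group G] [AddCommGroup M] [Module ℂ M] [AddCommGroup N] [Module ℂ N]
    (e : M ≃ₗ[ℂ] N) (π : Representation ℂ G M) : Representation ℂ G N where
  toFun g := e.conj (π g)
  map_one' := by
    rw [map_one]
    exact e.conj_id
  map_mul' g g' := by
    rw [map_mul]
    exact e.conj_comp _ _

theorem conjRep_apply {G M N : Type*} [Group G] [AddCommGroup M] [Module ℂ M] [AddCommGroup N]
    [Module ℂ N] (e : M ≃ₗ[ℂ] N) (π : Representation ℂ G M) (g : G) (m : M) :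
    conjRep e π g (e m) = e (π g m) := by
  simp [conjRep, LinearEquiv.conj_apply_apply]

variable {V : Type*} [NormedAddCommGroup V] [NormedSpace ℂ V] [CompleteSpace V]
  {G : Type*} [TopologicalSpace G] [ChartedSpace V G] [Group G] [LieGroup 𝓘(ℂ, V) ω G]
  {W : Type*} [NormedAddCommGroup W] [NormedSpace ℂ W] [CompleteSpace W]
  {P : Subgroup G} [ChartedSpace W P] [LieGroup 𝓘(ℂ, W) ω P]
  {E : Type u} [AddCommGroup E] [Module ℂ E] [TopologicalSpace E]
  [IsTopologicalAddGroup E] [ContinuousSMul ℂ E] [LocallyConvexSpace ℝ E] [T2Space E]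

/-- Left invariant operators commute with left translations. Thus every coefficient of the
transported representation is a function `D_l f` evaluated at a group element. -/
theorem taylorForm_comp_mul_left (f : holFun V G E) (a : G) (D : Env V G) :
    taylorForm ⟨fun h => f.1 (a * h), IsHolomorphic.mul_left f.2 a⟩ D =
      (leftInvAction V G E D f).1 a := by
  have key : taylorForm ⟨fun h => f.1 (a * h), IsHolomorphic.mul_left f.2 a⟩ =
      (LinearMap.proj a).comp ((holFun V G E).subtype.comp
        ((LinearMap.applyₗ f).comp (leftInvAction V G E).toLinearMap)) := by
    refine env_linearMap_ext fun D => ?_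
    rw [taylorForm_prod, leftInvDiffOp_comp_mul_left]
    simp only [mul_one]
    exact (congrFun (leftInvAction_prod D f) a).symm
  exact DFunLike.congr_fun key D

variable (V) in
/-- The action of `G` on `𝒪_ρ(G, E)` by left translations. -/
def translation (ρ : HolRep W E P) : Representation ℂ G (HolSections V ρ) where
  toFun g :=
    { toFun := fun f => ⟨fun h => f.1 (g⁻¹ * h), IsHolomorphic.mul_left f.2.1 g⁻¹,
        fun h p => by simpa only [mul_assoc] using f.2.2 (g⁻¹ * h) p⟩
      map_add' := fun _ _ => rfl
      map_smul' := fun _ _ => rfl }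
  map_one' := by
    ext f h
    simp
  map_mul' g g' := by
    ext f h
    simp [mul_assoc]

variable [ConnectedSpace G]

/-- The Taylor map as an isomorphism onto its image. -/
def taylorEquiv (hP : ContMDiff 𝓘(ℂ, W) 𝓘(ℂ, V) ω (Subtype.val : P → G)) (ρ : HolRep W E P) :
    HolSections V ρ ≃ₗ[ℂ] taylorRange hP ρ :=
  LinearEquiv.ofInjective (taylorMap hP ρ) (taylorMap_injective hP ρ)

theorem integratesHolomorphically_taylorRange
    (hP : ContMDiff 𝓘(ℂ, W) 𝓘(ℂ, V) ω (Subtype.val : P → G)) (ρ : HolRep W E P) :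
    IntegratesHolomorphically ρ (taylorRange hP ρ) := by
  let e := taylorEquiv hP ρ
  let π : Representation ℂ G (taylorRange hP ρ) := conjRep e (translation V ρ)
  have hπ : ∀ (g : G) (f : HolSections V ρ) (D : Env V G),
      (π g (e f)).1.1 D = (leftInvAction V G E D ⟨f.1, f.2.1⟩).1 g⁻¹ := by
    intro g f D
    have h1 : π g (e f) = e (translation V ρ g f) := conjRep_apply e _ g f
    rw [h1, ← taylorForm_comp_mul_left]
    rfl
  refine ⟨π, fun x γ hγ v D => ?_, fun v => ?_⟩
  · obtain ⟨f, rfl⟩ := e.surjective v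
    -- The coefficient at `D` along `γ` is `t ↦ (D_l f)(γ(t)⁻¹)`, with velocity `-(x_l D_l f)(1) =
    -- -Φ(f)(x D) = (x.Φ(f))(D)`.
    have h1 := IsHolomorphic.hasVelocity_mul_left_inv
      (leftInvAction V G E D ⟨f.1, f.2.1⟩).2 hγ 1
    rw [← leftInvAction_env, ← Module.End.mul_apply, ← map_mul, ← taylorForm_apply] at h1
    simp only [hπ]
    simp only [one_mul] at h1
    exact h1
  · obtain ⟨f, rfl⟩ := e.surjective v
    simp only [hπ, map_one]
    exact IsHolomorphic.comp_inv f.2.1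

end Integration

/-! ### Integrable submodules lie in the image -/

section Maximality

variable {V : Type*} [NormedAddCommGroup V] [NormedSpace ℂ V] [CompleteSpace V]
  {G : Type*} [TopologicalSpace G] [ChartedSpace V G] [Group G] [LieGroup 𝓘(ℂ, V) ω G]
  {W : Type*} [NormedAddCommGroup W] [NormedSpace ℂ W] [CompleteSpace W]
  {P : Subgroup G} [ChartedSpace W P] [LieGroup 𝓘(ℂ, W) ω P]
  {E : Type u} [AddCommGroup E] [Module ℂ E] [TopologicalSpace E]
  [IsTopologicalAddGroup E] [ContinuousSMul ℂ E] [LocallyConvexSpace ℝ E] [T2Space E]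

omit [ContinuousSMul ℂ E] [LocallyConvexSpace ℝ E] [T2Space E] in
theorem HasVelocity.comp_neg {c : ℝ → E} {e : E} (h : HasVelocity c e) :
    HasVelocity (fun t => c (-t)) (-e) := by
  have h1 : Tendsto (fun t : ℝ => -t) (𝓝[≠] 0) (𝓝[≠] 0) := by
    refine tendsto_nhdsWithin_iff.2 ⟨?_, ?_⟩
    · have : Continuous fun t : ℝ => -t := continuous_neg
      simpa using (this.tendsto 0).mono_left nhdsWithin_le_nhds
    · filter_upwards [self_mem_nhdsWithin] with t ht
      simpa using ht
  refine ((Tendsto.comp h h1).neg).congr fun t => ?_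
  simp [inv_neg]

theorem eq_of_leftInvDiffOp [ConnectedSpace G] {f f' : G → E} (hf : IsHolomorphic V f)
    (hf' : IsHolomorphic V f')
    (h : ∀ D : List (GroupLieAlgebra 𝓘(ℂ, V) G), leftInvDiffOp V D f 1 = leftInvDiffOp V D f' 1) :
    f = f' := by
  have h1 := eq_zero_of_leftInvDiffOp
    ((⟨f, hf⟩ : holFun V G E) - ⟨f', hf'⟩ : holFun V G E).2 fun D => by
      rw [← taylorForm_prod, map_sub, LinearMap.sub_apply, taylorForm_prod, taylorForm_prod, h,
        sub_self]
  exact sub_eq_zero.1 h1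

/-- Since `ρ(hp)⁻¹ = ρ(p)⁻¹ρ(h)⁻¹`, a right derivative keeps the shape `p ↦ ρ(p)⁻¹ e` and replaces
`e` by `-dρ(y)e`. -/
theorem HolRep.rightInvDiffOp_inv (ρ : HolRep W E P) (D : List (GroupLieAlgebra 𝓘(ℂ, W) P))
    (e : E) : rightInvDiffOp W D (fun p : P => ρ.toHom p⁻¹ e) =
      fun p => ρ.toHom p⁻¹ (D.foldl (fun e y => -ρ.derived y e) e) := by
  induction D generalizing e with
  | nil => rfl
  | cons y D ih =>
    have h1 : rightInvDeriv W y (fun p : P => ρ.toHom p⁻¹ e) =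
        fun p => ρ.toHom p⁻¹ (-ρ.derived y e) := by
      funext p
      have h2 := ((ρ.holomorphic e).comp_inv.hasVelocity_tangent 1 y).clm_comp (ρ.toHom p⁻¹)
      have h3 : (fun h : P => ρ.toHom (h * p)⁻¹ e) =
          fun h => ρ.toHom p⁻¹ (ρ.toHom h⁻¹ e) := by
        funext h
        simp
      have h4 := ρ.leftInvDeriv_inv y e
      simp only [leftInvDeriv, one_mul] at h4
      rw [rightInvDeriv, h3, ← h4]
      exact h2.velocity_eq
    rw [rightInvDiffOp_cons, h1, ih, List.foldl_cons]

-- The `𝔭`-condition strips letters from the right, giving the same recursion as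
-- `HolRep.rightInvDiffOp_inv`.
omit [CompleteSpace W] [LieGroup 𝓘(ℂ, W) ω P] in
theorem Coind.apply_prod {ρ : HolRep W E P} (β : Coind V ρ)
    (D : List (GroupLieAlgebra 𝓘(ℂ, W) P)) :
    β.1 ((D.map (lieIncl V W P)).map (env V G)).prod =
      D.foldl (fun e y => -ρ.derived y e) (β.1 1) := by
  induction D using List.reverseRecOn with
  | nil => simp
  | append_singleton D y ih =>
    rw [List.foldl_append, List.foldl_cons, List.foldl_nil, ← ih, ← β.2]
    simp

-- Along `g γ(t)` the vector is `π(γ(-t)) π(g⁻¹)v`, with velocity `-x.(π(g⁻¹)v)`; this sign cancels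
-- the one in `(x.β)(D) = -β(x D)`. Only the coefficient at 1 is assumed holomorphic; each step of
-- the induction supplies holomorphy of the next coefficient.
omit [CompleteSpace W] [LieGroup 𝓘(ℂ, W) ω P] in
theorem leftInvDiffOp_of_integrates {ρ : HolRep W E P}
    {N : LieSubmodule ℂ (GroupLieAlgebra 𝓘(ℂ, V) G) (Coind V ρ)} {π : Representation ℂ G N}
    (hπ : ∀ (x : GroupLieAlgebra 𝓘(ℂ, V) G) (γ : ℝ → G), IsOneParameterGroup V x γ →
      ∀ (v : N) (D : Env V G), HasVelocity (fun t => (π (γ t) v).1.1 D) ((⁅x, v⁆ : N).1.1 D))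
    {v : N} (hv : IsHolomorphic V (fun g => (π g⁻¹ v).1.1 1))
    (D : List (GroupLieAlgebra 𝓘(ℂ, V) G)) :
    leftInvDiffOp V D (fun g => (π g⁻¹ v).1.1 1) =
      fun g => (π g⁻¹ v).1.1 (D.map (env V G)).prod := by
  induction D with
  | nil => simp [leftInvDiffOp_nil]
  | cons x D ih =>
    have h1 := hv.leftInvDiffOp D
    rw [leftInvDiffOp_cons]
    rw [ih] at h1 ⊢
    funext g
    obtain ⟨γ, hγ⟩ := exists_isOneParameterGroup x
    have h2 := h1.hasVelocity_mul_left hγ g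
    have h3 := (hπ x γ hγ (π g⁻¹ v) (D.map (env V G)).prod).comp_neg
    simp only [mul_inv_rev, hγ.inv_eq, map_mul, Module.End.mul_apply] at h2
    rw [h2.velocity_eq.symm.trans h3.velocity_eq]
    have h4 : (⁅x, π g⁻¹ v⁆ : N).1.1 (D.map (env V G)).prod =
        -(π g⁻¹ v).1.1 (env V G x * (D.map (env V G)).prod) :=
      coind_lie_apply ρ x (π g⁻¹ v).1 _
    have h5 : ((x :: D).map (env V G)).prod = env V G x * (D.map (env V G)).prod := by simp
    rw [h5]
    exact neg_eq_iff_eq_neg.2 h4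

theorem le_taylorRange [ConnectedSpace P]
    (hP : ContMDiff 𝓘(ℂ, W) 𝓘(ℂ, V) ω (Subtype.val : P → G)) {ρ : HolRep W E P}
    {N : LieSubmodule ℂ (GroupLieAlgebra 𝓘(ℂ, V) G) (Coind V ρ)}
    (hN : IntegratesHolomorphically ρ N) : N ≤ taylorRange hP ρ := by
  obtain ⟨π, hπ, hhol⟩ := hN
  intro w hw
  set v : N := ⟨w, hw⟩
  set f : G → E := fun g => (π g⁻¹ v).1.1 1
  have hfh : IsHolomorphic V f := IsHolomorphic.comp_inv (hhol v)
  have hD : ∀ D, leftInvDiffOp V D f = fun g => (π g⁻¹ v).1.1 (D.map (env V G)).prod :=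
    leftInvDiffOp_of_integrates hπ hfh
  have hequiv : ∀ (g : G) (p : P), f (g * p) = ρ.toHom p⁻¹ (f g) := by
    intro g
    -- The identity theorem on `P`: both sides have the Taylor coefficients of `π(g⁻¹)v` along words
    -- in `𝔭`.
    refine congrFun (eq_of_leftInvDiffOp ((hfh.mul_left g).comp_contMDiff hP)
      (ρ.holomorphic (f g)).comp_inv fun D => ?_)
    rw [leftInvDiffOp_comp_val hP (hfh.mul_left g), leftInvDiffOp_comp_mul_left,
      ← rightInvDiffOp_one (ρ.holomorphic (f g)).comp_inv, ρ.rightInvDiffOp_inv]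
    simp only [OneMemClass.coe_one, mul_one, inv_one, map_one, hD]
    exact Coind.apply_prod (π g⁻¹ v).1 D
  refine ⟨⟨f, hfh, hequiv⟩, Subtype.ext (env_linearMap_ext fun D => ?_)⟩
  rw [taylorMap_apply, taylorForm_prod, hD]
  simp [v]

end Maximality

end HolInd

end

theorem mainTheorem10
    -- a connected complex Banach-Lie group `G`, modelled on the Banach space `V`
    {V : Type*} [NormedAddCommGroup V] [NormedSpace ℂ V] [CompleteSpace V]
    {G : Type*} [TopologicalSpace G] [ChartedSpace V G] [Group G] [LieGroup 𝓘(ℂ, V) ω G]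
    [ConnectedSpace G]
    -- a connected complex Lie subgroup `P` (with the subspace topology), modelled on `W`
    {W : Type*} [NormedAddCommGroup W] [NormedSpace ℂ W] [CompleteSpace W]
    (P : Subgroup G) [ChartedSpace W P] [LieGroup 𝓘(ℂ, W) ω P]
    (hP : ContMDiff 𝓘(ℂ, W) 𝓘(ℂ, V) ω (Subtype.val : P → G)) [ConnectedSpace P]
    -- a Hausdorff locally convex space `E` and a representation `ρ` of `P` on it
    {E : Type*} [AddCommGroup E] [Module ℂ E] [TopologicalSpace E] [IsTopologicalAddGroup E]
    [ContinuousSMul ℂ E] [LocallyConvexSpace ℝ E] [T2Space E]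
    (ρ : HolInd.HolRep W E P) :
    ∃ Φ : HolInd.HolSections V ρ →ₗ[ℂ] HolInd.Coind V ρ,
      HolInd.IsTaylorMap ρ Φ ∧
      ∃ N : LieSubmodule ℂ (GroupLieAlgebra 𝓘(ℂ, V) G) (HolInd.Coind V ρ),
        N.toSubmodule = LinearMap.range Φ ∧
        IsGreatest {N' : LieSubmodule ℂ (GroupLieAlgebra 𝓘(ℂ, V) G) (HolInd.Coind V ρ) |
          HolInd.IntegratesHolomorphically ρ N'} N := by
  exact ⟨HolInd.taylorMap hP ρ, HolInd.isTaylorMap_taylorMap hP ρ, HolInd.taylorRange hP ρ, rfl,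
    HolInd.integratesHolomorphically_taylorRange hP ρ, fun _ hN => HolInd.le_taylorRange hP hN⟩
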